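/- Let $d\ge 1$, let $\Lambda$ be a finite nonempty set and let $\Phi=\{\varphi_i:\mathbb{R}^d\to\mathbb{R}^d\}_{i\in\Lambda}$ be a similarity IFS, i.e. for every $i$ there is $r_i\in(0,1)$ with $\|\varphi_i(x)-\varphi_i(y)\|=r_i\|x-y\|$ for all $x,y$ (Euclidean norm). Let $K$ be its attractor, the unique nonempty compact set with $K=\bigcup_{i\in\Lambda}\varphi_i(K)$. Let $W$ be a random subset of $\Lambda$ with $\mathbb{P}(i\in W)>0$ for every $i\in\Lambda$ and $\mathbb{E}|W|>1$, and let $(W_a)_{a\in\Lambda^*}$ be independent copies of $W$ indexed by the finite words over $\Lambda$. Put $T_0=\{\emptyset\}$ and $T_{n+1}=\bigcup_{a\in T_n}\{aj: j\in W_a\}$, and let $\partial T$ be the set of $x\in\Lambda^{\mathbb{N}}$ with $x_1\dots x_n\in T_n$ for all $n$. The Galton–Watson fractal with respect to $\Phi$ and offspring distribution $W$ is $$E=\bigcup_{x\in\partial T}\ \bigcap_{n\ge 1}\varphi_{x_1}\circ\dots\circ\varphi_{x_n}(K).$$ Nonextinction is the event that $T_n\ne\emptyset$ for all $n$. Suppose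 that $E$ is non-planar: it is not the case that almost surely $E$ is contained in some affine hyperplane (an affine subspace of dimension $d-1$). A closed set $D\subseteq\mathbb{R}^d$ is called hyperplane diffuse if there are $\beta,\xi_0>0$ such that for all $\xi\in(0,\xi_0)$, all $x\in D$ and all affine hyperplanes $L\subset\mathbb{R}^d$, some point of $D\cap B_\xi(x)$ is not in the open $\beta\xi$-neighborhood of $L$. A set $D\subseteq\mathbb{R}^d$ is called Ahlfors-regular if there are $\delta,c_1,c_2>0$ and a Borel measure $\mu$ on $\mathbb{R}^d$ with $\operatorname{supp}\mu=D$ and $c_1\rho^\delta\le\mu(B_\rho(x))\le c_2\rho^\delta$ for all $\rho\in(0,1)$ and all $x\in D$. (Here $B_\rho(x)$ are open balls.) Then: 1. Almost surely conditioned on nonextinction, $E$ contains a nonempty hyperplane diffuse subset. 2. If moreover $\Phi$ satisfies the open set condition, i.e. there is a nonempty open $U\subseteq\mathbb{R}^d$ with $\varphi_i(U)\subseteq U$ for all $i$ and $\varphi_i(U)\cap\varphi_j(U)=\emptyset$ for $i\neq j$, then almost surely conditioned on nonextinction there is a sequence $(D_n)_{n\in\mathbb{N}}$ of nonempty subsets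 of $E$, each of them hyperplane diffuse and Ahlfors-regular, such that $\dim_H(D_n)$ is strictly increasing in $n$ and converges to $\dim_H(E)$. -/

import Mathlib

open MeasureTheory ProbabilityTheory Filter Topology
open scoped NNReal ENNReal

namespace GWFractal

/-- The Euclidean space `ℝ^d`. -/
abbrev Euc (d : ℕ) : Type := EuclideanSpace ℝ (Fin d)

/-! ### Affine hyperplanes, hyperplane diffuse sets, Ahlfors-regular sets -/

/-- A (nonempty) affine subspace of `ℝ^d` of dimension `d - 1`. -/
def IsHyperplane {d : ℕ} (L : AffineSubspace ℝ (Euc d)) : Prop :=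
  (L : Set (Euc d)).Nonempty ∧ Module.finrank ℝ L.direction + 1 = d

/-- A closed set `K` is hyperplane `β`-diffuse if for all small `ξ > 0`, all `x ∈ K` and all affine
hyperplanes `L`, the set `K ∩ B_ξ(x)` is not contained in the `βξ`-neighborhood of `L`. -/
def HyperplaneDiffuseWith {d : ℕ} (β : ℝ) (K : Set (Euc d)) : Prop :=
  IsClosed K ∧ ∃ ξ₀ : ℝ, 0 < ξ₀ ∧ ∀ ξ : ℝ, 0 < ξ → ξ < ξ₀ → ∀ x ∈ K,
    ∀ L : AffineSubspace ℝ (Euc d), IsHyperplane L →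
      ((K ∩ Metric.ball x ξ) \ Metric.thickening (β * ξ) (L : Set (Euc d))).Nonempty

/-- `K` is hyperplane diffuse if it is hyperplane `β`-diffuse for some `β > 0`. -/
def HyperplaneDiffuse {d : ℕ} (K : Set (Euc d)) : Prop :=
  ∃ β : ℝ, 0 < β ∧ HyperplaneDiffuseWith β K

/-- A Borel measure on `ℝ^d` is `δ`-Ahlfors-regular if `c₁ ρ^δ ≤ μ (B_ρ(x)) ≤ c₂ ρ^δ` for all
`ρ ∈ (0,1)` and all `x` in the support of `μ`. -/
def AhlforsRegularMeasure {d : ℕ} (δ : ℝ) (μ : Measure (Euc d)) : Prop :=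
  ∃ c₁ c₂ : ℝ, 0 < c₁ ∧ 0 < c₂ ∧ ∀ ρ : ℝ, 0 < ρ → ρ < 1 → ∀ x ∈ μ.support,
    ENNReal.ofReal (c₁ * ρ ^ δ) ≤ μ (Metric.ball x ρ) ∧
      μ (Metric.ball x ρ) ≤ ENNReal.ofReal (c₂ * ρ ^ δ)

/-- A set is Ahlfors-regular if it is the support of a `δ`-Ahlfors-regular measure, for some
`δ > 0`. -/
def AhlforsRegular {d : ℕ} (K : Set (Euc d)) : Prop :=
  ∃ δ : ℝ, 0 < δ ∧ ∃ μ : Measure (Euc d), AhlforsRegularMeasure δ μ ∧ μ.support = K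

/-! ### Similarity iterated function systems -/

/-- `f` is a contracting similarity: it multiplies all distances by some ratio `r ∈ (0,1)`. -/
def IsContractingSimilarity {d : ℕ} (f : Euc d → Euc d) : Prop :=
  ∃ r : ℝ, 0 < r ∧ r < 1 ∧ ∀ x y, dist (f x) (f y) = r * dist x y

/-- A similarity IFS on `ℝ^d` indexed by `Λ` (`Λ` is finite wherever it is used). -/
structure SimilarityIFS (d : ℕ) (Λ : Type*) where
  map : Λ → Euc d → Euc d
  isContractingSimilarity : ∀ i, IsContractingSimilarity (map i)

namespace SimilarityIFS

variable {d : ℕ} {Λ : Type*}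

/-- `K` is nonempty, compact and `K = ⋃ i, φ_i K`. -/
def IsAttractor (Φ : SimilarityIFS d Λ) (K : Set (Euc d)) : Prop :=
  K.Nonempty ∧ IsCompact K ∧ K = ⋃ i, Φ.map i '' K

theorem exists_lipschitz [Finite Λ] (Φ : SimilarityIFS d Λ) :
    ∃ r : ℝ≥0, r < 1 ∧ ∀ i, LipschitzWith r (Φ.map i) := by
  classical
  cases nonempty_fintype Λ
  choose r h0 h1 hr using Φ.isContractingSimilarity
  refine ⟨Finset.univ.sup fun i => (r i).toNNReal, ?_, fun i => ?_⟩
  · rw [Finset.sup_lt_iff (by simp)]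
    intro i _
    simpa using h1 i
  · refine LipschitzWith.of_dist_le_mul fun x y => ?_
    rw [hr]
    refine mul_le_mul_of_nonneg_right ?_ dist_nonneg
    have h : (r i).toNNReal ≤ Finset.univ.sup fun i => (r i).toNNReal :=
      Finset.le_sup (f := fun i => (r i).toNNReal) (Finset.mem_univ i)
    calc r i ≤ ((r i).toNNReal : ℝ) := Real.le_coe_toNNReal _
      _ ≤ _ := by exact_mod_cast h

/-- The attractor exists and is unique. -/
theorem existsUnique_attractor [Finite Λ] [Nonempty Λ] (Φ : SimilarityIFS d Λ) :
    ∃! K : Set (Euc d), Φ.IsAttractor K := by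
  obtain ⟨r, hr, hL⟩ := Φ.exists_lipschitz
  let F : TopologicalSpace.NonemptyCompacts (Euc d) → TopologicalSpace.NonemptyCompacts (Euc d) :=
    fun K => ⟨⟨⋃ i, Φ.map i '' K,
      isCompact_iUnion fun i => K.isCompact.image (hL i).continuous⟩,
      Set.nonempty_iUnion.2 ⟨Classical.arbitrary Λ, K.nonempty.image _⟩⟩
  have key : ∀ (i : Λ) (s t : TopologicalSpace.NonemptyCompacts (Euc d)),
      ∀ x ∈ (s : Set (Euc d)), ∃ y ∈ Φ.map i '' (t : Set (Euc d)),
        edist (Φ.map i x) y ≤ r * Metric.hausdorffEDist (s : Set (Euc d)) t := by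
    intro i s t x hx
    obtain ⟨y, hy, hxy⟩ := t.isCompact.exists_infEDist_eq_edist t.nonempty x
    refine ⟨_, ⟨y, hy, rfl⟩, (hL i x y).trans ?_⟩
    rw [← hxy]
    gcongr
    exact Metric.infEDist_le_hausdorffEDist_of_mem hx
  have hF : ContractingWith r F := by
    refine ⟨hr, fun s t => ?_⟩
    change Metric.hausdorffEDist (⋃ i, Φ.map i '' (s : Set (Euc d)))
      (⋃ i, Φ.map i '' (t : Set (Euc d))) ≤ r * Metric.hausdorffEDist (s : Set (Euc d)) t
    refine Metric.hausdorffEDist_iUnion_le.trans (iSup_le fun i => ?_)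
    refine Metric.hausdorffEDist_le_of_mem_edist ?_ ?_
    · rintro _ ⟨x, hx, rfl⟩
      exact key i s t x hx
    · rintro _ ⟨x, hx, rfl⟩
      rw [Metric.hausdorffEDist_comm]
      exact key i t s x hx
  have : Nonempty (TopologicalSpace.NonemptyCompacts (Euc d)) :=
    ⟨⟨⟨{0}, isCompact_singleton⟩, Set.singleton_nonempty _⟩⟩
  obtain ⟨K₀, hfix⟩ : ∃ K₀, Function.IsFixedPt F K₀ := ⟨_, hF.fixedPoint_isFixedPt⟩
  refine ⟨(K₀ : Set (Euc d)), ⟨K₀.nonempty, K₀.isCompact, ?_⟩, ?_⟩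
  · exact (congrArg (fun K : TopologicalSpace.NonemptyCompacts (Euc d) => (K : Set (Euc d)))
      hfix).symm
  · rintro K ⟨hne, hK, heq⟩
    have h : Function.IsFixedPt F ⟨⟨K, hK⟩, hne⟩ :=
      TopologicalSpace.NonemptyCompacts.ext heq.symm
    exact congrArg (fun K : TopologicalSpace.NonemptyCompacts (Euc d) => (K : Set (Euc d)))
      (hF.fixedPoint_unique' h hfix)

/-- The attractor of a similarity IFS. -/
noncomputable def attractor [Finite Λ] [Nonempty Λ] (Φ : SimilarityIFS d Λ) : Set (Euc d) :=
  Φ.existsUnique_attractor.exists.choose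

theorem isAttractor_attractor [Finite Λ] [Nonempty Λ] (Φ : SimilarityIFS d Λ) :
    Φ.IsAttractor Φ.attractor :=
  Φ.existsUnique_attractor.exists.choose_spec

/-- `φ_{i₁ … i_n} = φ_{i₁} ∘ ⋯ ∘ φ_{i_n}`, with `φ_∅ = id`. -/
def wordMap (Φ : SimilarityIFS d Λ) : List Λ → Euc d → Euc d
  | [] => id
  | i :: w => Φ.map i ∘ Φ.wordMap w

/-- The open set condition. -/
def OpenSetCondition (Φ : SimilarityIFS d Λ) : Prop :=
  ∃ U : Set (Euc d), IsOpen U ∧ U.Nonempty ∧ (∀ i, Φ.map i '' U ⊆ U) ∧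
    ∀ i j, i ≠ j → Disjoint (Φ.map i '' U) (Φ.map j '' U)

end SimilarityIFS

/-! ### Galton–Watson trees and fractals

Finite words over the alphabet `Λ` are lists; `w a` is the set of letters by which the word `a` may
be continued in the tree. -/

variable {Λ : Type*}

/-- The `n`-th level of the tree: `T₀ = {∅}`, `T_{n+1} = ⋃_{a ∈ T_n} {a j : j ∈ w a}`. -/
def treeLevel (w : List Λ → Set Λ) : ℕ → Set (List Λ)
  | 0 => {[]}
  | n + 1 => {b | ∃ a ∈ treeLevel w n, ∃ j ∈ w a, b = a ++ [j]}

/-- Nonextinction: every level of the tree is nonempty. -/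
def Survives (w : List Λ → Set Λ) : Prop :=
  ∀ n, (treeLevel w n).Nonempty

/-- The prefix of length `n` of an infinite word. -/
def prefixWord (x : ℕ → Λ) (n : ℕ) : List Λ :=
  List.ofFn fun k : Fin n => x k

/-- The boundary of the tree: infinite words all of whose finite prefixes lie in the tree. -/
def treeBoundary (w : List Λ → Set Λ) : Set (ℕ → Λ) :=
  {x | ∀ n, prefixWord x n ∈ treeLevel w n}

/-- The projection of the boundary of the tree through the coding map,
`⋃_{x ∈ ∂T} ⋂_n φ_{x₁ … x_n}(K)`, where `K` is the attractor; each intersection is a single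
point, the value of the coding map at `x`. -/
def limitSet {d : ℕ} [Finite Λ] [Nonempty Λ] (Φ : SimilarityIFS d Λ) (w : List Λ → Set Λ) :
    Set (Euc d) :=
  ⋃ x ∈ treeBoundary w, ⋂ n : ℕ, Φ.wordMap (prefixWord x n) '' Φ.attractor

/-- `(W a)`, `a` ranging over the finite words, is a family of independent random subsets of `Λ`,
all with the offspring distribution `ν`. -/
structure IsGaltonWatsonFamily {Ω : Type*} [MeasurableSpace Ω] (W : List Λ → Ω → Set Λ)
    (ν : Measure (Set Λ)) (P : Measure Ω) : Prop where
  measurable : ∀ a, Measurable (W a)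
  map_eq : ∀ a, P.map (W a) = ν
  iIndepFun : iIndepFun W P

/-- The random fractal is non-planar: it is not almost surely contained in an affine hyperplane. -/
def NonPlanar {d : ℕ} [Finite Λ] [Nonempty Λ] {Ω : Type*} [MeasurableSpace Ω]
    (Φ : SimilarityIFS d Λ) (W : List Λ → Ω → Set Λ) (P : Measure Ω) : Prop :=
  ¬ ∀ᵐ ω ∂P, ∃ L : AffineSubspace ℝ (Euc d), IsHyperplane L ∧
    limitSet Φ (fun a => W a ω) ⊆ (L : Set (Euc d))

end GWFractal

set_option linter.unusedSectionVars false

/-! Let `δ` solve `∑ p_i r_i ^ δ = 1`, where `p_i` is the probability that the letter `i` is an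
offspring. First moments give `dim E ≤ δ` almost surely, with no separation condition. It remains to
find in the tree, almost surely on survival, subtrees that are completely regular, that leave every
hyperplane at every scale, and whose dimension is as close to `δ` as desired.

Diffuseness comes from a finite block. By compactness of the set of unit normals, non-planarity
yields a finite set `B` of words, jointly in the tree with positive probability, such that every
hyperplane keeps a fixed distance from the cylinder of some word of `B` (`exists_spread_level`,
`exists_spread_finset`). Padding the words makes their lengths and ratios equal
(`exists_homogeneous_spread_finset`).

Dimension comes from second moments. The sum of `r_v ^ δ` over the words `v` of level `k` is bounded
in `L²` uniformly in `k` (`exists_pairProb_bound`). Sorting words by letter counts gives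
polynomially many classes of constant ratio, so one class `V`, of ratio `R`, has expected size at
least `R ^ (-δ)` up to a polynomial factor in `k`. For `t < δ`, the Paley–Zygmund argument then
finds about `R ^ (-t)` words of `V` in the tree, each followed by the whole block `B` with a given
event below each of its words. The probability obtained is polynomially small in `k` but does not
depend on that event, as long as the event is itself not less likely than this bound: the
exponential gap `R ^ (-(δ - t))` absorbs all polynomial losses. Hence the bound survives iteration,
and the limiting event has positive probability (`envLaw_iInter_coreSet_ne_zero`, `exists_core`). On
it the tree contains a `HomogeneousTree`: constant number of children, constant ratio, a scaled copy
of the block below every node.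

Strict convexity of the offspring generating function shows that almost surely on survival this
event is seen from some word of the tree (`ae_survives_imp_exists_shift_mem`). The set coded by the
homogeneous tree is diffuse, and under the open set condition its uniform measure is Ahlfors-regular
with exponent in `[t, t']`. Disjoint intervals `[t, t']` increasing to `δ` give the sequence `D_n`,
and also force `dim E = δ`. -/

namespace GWFractal

/-! ### Trees -/

section Tree

variable {Λ : Type*}

/-- The environment seen from the word `v`. -/
def shift (v : List Λ) (w : List Λ → Set Λ) : List Λ → Set Λ := fun a => w (v ++ a)

/-- The word `v` belongs to the tree of the environment `w`. -/
def InTree (w : List Λ → Set Λ) (v : List Λ) : Prop :=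
  ∀ u j, u ++ [j] <+: v → j ∈ w u

@[simp] theorem shift_nil (w : List Λ → Set Λ) : shift [] w = w := rfl

theorem shift_shift (u v : List Λ) (w : List Λ → Set Λ) :
    shift v (shift u w) = shift (u ++ v) w := by
  funext a
  simp [shift]

@[simp] theorem inTree_nil (w : List Λ → Set Λ) : InTree w [] := by
  intro u j h
  simp at h

/-- The branching property in deterministic form. The environment is defined on all words, including
those outside the tree, so the shifted environment makes sense at every word and independence never
has to be conditional. -/
theorem inTree_append (w : List Λ → Set Λ) (a b : List Λ) :
    InTree w (a ++ b) ↔ InTree w a ∧ InTree (shift a w) b := by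
  constructor
  · intro h
    refine ⟨fun u j hu => h u j (hu.trans (List.prefix_append a b)), fun u j hu => ?_⟩
    refine h (a ++ u) j ?_
    rw [List.append_assoc]
    exact (List.prefix_append_right_inj a).2 hu
  · rintro ⟨h1, h2⟩ u j hu
    rcases Nat.lt_or_ge u.length a.length with hl | hl
    · refine h1 u j (List.prefix_of_prefix_length_le hu (List.prefix_append a b) ?_)
      simpa using hl
    · obtain ⟨t, rfl⟩ : a <+: u :=
        List.prefix_of_prefix_length_le (List.prefix_append a b)
          ((List.prefix_append u [j]).trans hu) hl
      rw [List.append_assoc, List.prefix_append_right_inj] at hu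
      exact h2 t j hu

@[simp] theorem inTree_singleton (w : List Λ → Set Λ) (i : Λ) : InTree w [i] ↔ i ∈ w [] := by
  constructor
  · intro h
    exact h [] i (by simp)
  · intro h u j hu
    have hl := hu.length_le
    obtain rfl : u = [] := by simpa using hl
    obtain rfl : j = i := by simpa using hu
    exact h

theorem inTree_cons (w : List Λ → Set Λ) (i : Λ) (a : List Λ) :
    InTree w (i :: a) ↔ i ∈ w [] ∧ InTree (shift [i] w) a := by
  rw [← List.singleton_append, inTree_append, inTree_singleton]

theorem mem_treeLevel_iff (w : List Λ → Set Λ) (n : ℕ) (v : List Λ) :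
    v ∈ treeLevel w n ↔ v.length = n ∧ InTree w v := by
  induction n generalizing v with
  | zero =>
    simp only [treeLevel, Set.mem_singleton_iff, List.length_eq_zero_iff]
    constructor
    · rintro rfl
      simp
    · exact fun h => h.1
  | succ n ih =>
    simp only [treeLevel, Set.mem_ofPred_eq]
    constructor
    · rintro ⟨a, ha, j, hj, rfl⟩
      rw [ih] at ha
      refine ⟨by simp [ha.1], ?_⟩
      rw [inTree_append, inTree_singleton]
      exact ⟨ha.2, by simpa [shift] using hj⟩
    · rintro ⟨hl, hT⟩
      obtain ⟨a, j, rfl⟩ : ∃ a j, v = a ++ [j] := by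
        rcases List.eq_nil_or_concat v with rfl | ⟨a, j, rfl⟩
        · simp at hl
        · exact ⟨a, j, by simp⟩
      rw [inTree_append, inTree_singleton] at hT
      refine ⟨a, (ih a).2 ⟨by simpa using hl, hT.1⟩, j, by simpa [shift] using hT.2, rfl⟩

theorem survives_iff (w : List Λ → Set Λ) :
    Survives w ↔ ∀ n, ∃ v, v.length = n ∧ InTree w v := by
  simp only [Survives, Set.Nonempty, mem_treeLevel_iff]

end Tree

/-! ### Words of a given length -/

section Words

variable {Λ : Type*} [Fintype Λ] [DecidableEq Λ]

/-- The finite set of words of length `k`. -/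
def words (Λ : Type*) [Fintype Λ] [DecidableEq Λ] : ℕ → Finset (List Λ)
  | 0 => {[]}
  | k + 1 => (Finset.univ ×ˢ words Λ k).image fun p => p.1 :: p.2

@[simp] theorem mem_words {k : ℕ} {v : List Λ} : v ∈ words Λ k ↔ v.length = k := by
  induction k generalizing v with
  | zero => simp [words]
  | succ k ih =>
    cases v with
    | nil => simp [words]
    | cons i v => simp [words, ih]

theorem sum_words_succ {M : Type*} [AddCommMonoid M] (k : ℕ) (f : List Λ → M) :
    ∑ v ∈ words Λ (k + 1), f v = ∑ i, ∑ v ∈ words Λ k, f (i :: v) := by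
  rw [words, Finset.sum_image, Finset.sum_product]
  rintro ⟨i, a⟩ _ ⟨j, b⟩ _ h
  simpa using h

end Words

/-! ### The canonical probability space -/

section Canonical

variable {Λ : Type*}

/-- The law of the environment: independent offspring sets with distribution `ν`. -/
noncomputable def envLaw (ν : Measure (Set Λ)) : Measure (List Λ → Set Λ) :=
  Measure.infinitePi fun _ => ν

variable (ν : Measure (Set Λ)) [IsProbabilityMeasure ν]

instance : IsProbabilityMeasure (envLaw ν) := by
  unfold envLaw
  infer_instance

theorem measurable_shift (v : List Λ) : Measurable (shift v : (List Λ → Set Λ) → _) :=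
  measurable_pi_iff.2 fun a => measurable_pi_apply (v ++ a)

theorem measurePreserving_shift (v : List Λ) :
    MeasurePreserving (shift v) (envLaw ν) (envLaw ν) :=
  ⟨measurable_shift v, Measure.map_infinitePi_infinitePi_of_inj (P := fun _ : List Λ => ν)
    (f := fun a => v ++ a) (List.append_right_injective v)⟩

/-- The σ-algebra generated by the offspring sets of the words in `S`. -/
@[reducible] def sigmaOn (S : Set (List Λ)) : MeasurableSpace (List Λ → Set Λ) :=
  ⨆ a ∈ S, MeasurableSpace.comap (fun w : List Λ → Set Λ => w a) inferInstance

theorem sigmaOn_mono {S T : Set (List Λ)} (h : S ⊆ T) : sigmaOn S ≤ sigmaOn T :=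
  biSup_mono fun _ ha => h ha

theorem sigmaOn_le (S : Set (List Λ)) : sigmaOn S ≤ MeasurableSpace.pi :=
  iSup₂_le fun a _ => (measurable_pi_apply a).comap_le

theorem measurable_eval_sigmaOn {S : Set (List Λ)} {a : List Λ} (ha : a ∈ S) :
    Measurable[sigmaOn S] fun w : List Λ → Set Λ => w a := by
  have h : MeasurableSpace.comap (fun w : List Λ → Set Λ => w a) inferInstance ≤ sigmaOn S :=
    le_iSup₂ (f := fun a (_ : a ∈ S) =>
      MeasurableSpace.comap (fun w : List Λ → Set Λ => w a) inferInstance) a ha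
  exact Measurable.mono (comap_measurable _) h le_rfl

theorem indep_sigmaOn {S T : Set (List Λ)} (h : Disjoint S T) :
    Indep (sigmaOn S) (sigmaOn T) (envLaw ν) := by
  refine indep_iSup_of_disjoint (fun a => (measurable_pi_apply a).comap_le) ?_ h
  exact (iIndepFun_infinitePi (P := fun _ : List Λ => ν) (X := fun _ s => s)
    fun _ => measurable_id)

theorem measurable_shift_sigmaOn (v : List Λ) :
    Measurable[sigmaOn {a | v <+: a}] (shift v : (List Λ → Set Λ) → _) :=
  @measurable_pi_iff _ _ _ (sigmaOn {a | v <+: a}) _ _ |>.2 fun a =>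
    measurable_eval_sigmaOn (List.prefix_append v a)

/-- Subtrees rooted at distinct words of length `k` are independent of each other and of the first
`k` generations. -/
theorem envLaw_inter_shift (k : ℕ) (S : Finset (List Λ)) (hS : ∀ v ∈ S, v.length = k)
    {C : Set (List Λ → Set Λ)} (hC : MeasurableSet[sigmaOn {a | a.length < k}] C)
    {A : List Λ → Set (List Λ → Set Λ)} (hA : ∀ v ∈ S, MeasurableSet (A v)) :
    envLaw ν (C ∩ {w | ∀ v ∈ S, shift v w ∈ A v}) = envLaw ν C * ∏ v ∈ S, envLaw ν (A v) := by
  classical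
  induction S using Finset.induction_on with
  | empty => simp
  | insert v S hv ih =>
    have hset : C ∩ {w | ∀ u ∈ insert v S, shift u w ∈ A u}
        = (C ∩ {w | ∀ u ∈ S, shift u w ∈ A u}) ∩ shift v ⁻¹' A v := by
      ext w
      simp only [Finset.mem_insert, forall_eq_or_imp, Set.mem_inter_iff, Set.mem_ofPred_eq,
        Set.mem_preimage]
      tauto
    have hlen : v.length = k := hS v (Finset.mem_insert_self v S)
    -- The subtree at `v` is peeled off. All other events live on words that do not extend `v`: they
    -- are shorter than `k`, or extend another word of the same length.
    have hI := indep_sigmaOn ν (S := {a | ¬ v <+: a}) (T := {a | v <+: a})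
      (Set.disjoint_left.2 fun a h1 h2 => h1 h2)
    rw [Indep_iff] at hI
    rw [hset, hI _ _ ?_ (measurable_shift_sigmaOn v (hA v (Finset.mem_insert_self v S))),
      ih (fun u hu => hS u (Finset.mem_insert_of_mem hu))
        (fun u hu => hA u (Finset.mem_insert_of_mem hu)),
      (measurePreserving_shift ν v).measure_preimage
        (hA v (Finset.mem_insert_self v S)).nullMeasurableSet, Finset.prod_insert hv]
    · ring
    · refine MeasurableSet.inter ?_ ?_
      · refine sigmaOn_mono (fun a ha h => ?_) _ hC
        have h1 : a.length < k := ha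
        have h2 := h.length_le
        omega
      · have : {w : List Λ → Set Λ | ∀ u ∈ S, shift u w ∈ A u}
            = ⋂ u ∈ S, shift u ⁻¹' A u := by
          ext w
          simp
        rw [this]
        refine Finset.measurableSet_biInter S fun u hu => ?_
        refine sigmaOn_mono (fun a ha h => ?_) _
          (measurable_shift_sigmaOn u (hA u (Finset.mem_insert_of_mem hu)))
        have huk : u.length = k := hS u (Finset.mem_insert_of_mem hu)
        have : u = v := by
          have := List.prefix_of_prefix_length_le (show u <+: a from ha) h (by omega)
          exact this.eq_of_length (by omega)
        exact hv (this ▸ hu)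

/-- Membership of `v` is decided by the offspring sets at the proper prefixes of `v`, all shorter
than `v`. -/
theorem measurableSet_inTree_sigmaOn {k : ℕ} {v : List Λ} (hv : v.length ≤ k) :
    MeasurableSet[sigmaOn {a | a.length < k}] {w : List Λ → Set Λ | InTree w v} := by
  induction v using List.reverseRecOn with
  | nil => simp
  | append_singleton a i ih =>
    have h : {w : List Λ → Set Λ | InTree w (a ++ [i])}
        = {w | InTree w a} ∩ (fun w => w a) ⁻¹' {s | i ∈ s} := by
      ext w
      simp [inTree_append, shift]
    have hl : a.length < k := by simpa using hv
    rw [h]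
    exact MeasurableSet.inter (ih hl.le)
      (measurable_eval_sigmaOn (S := {a | a.length < k}) hl (measurableSet_mem i))

theorem measurableSet_inTree (v : List Λ) : MeasurableSet {w : List Λ → Set Λ | InTree w v} :=
  sigmaOn_le _ _ (measurableSet_inTree_sigmaOn (le_refl v.length))

theorem measurableSet_survives [Countable Λ] :
    MeasurableSet {w : List Λ → Set Λ | Survives w} := by
  have : {w : List Λ → Set Λ | Survives w}
      = ⋂ n : ℕ, ⋃ v : List Λ, ⋃ _ : v.length = n, {w | InTree w v} := by
    ext w
    simp [survives_iff]
  rw [this]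
  exact MeasurableSet.iInter fun n => MeasurableSet.iUnion fun v => MeasurableSet.iUnion fun _ =>
    measurableSet_inTree v

end Canonical

/-! ### First and second moments -/

section Moments

variable {Λ : Type*} (ν : Measure (Set Λ)) [IsProbabilityMeasure ν]

theorem envLaw_real_inter_shift (k : ℕ) (S : Finset (List Λ)) (hS : ∀ v ∈ S, v.length = k)
    {C : Set (List Λ → Set Λ)} (hC : MeasurableSet[sigmaOn {a | a.length < k}] C)
    {A : List Λ → Set (List Λ → Set Λ)} (hA : ∀ v ∈ S, MeasurableSet (A v)) :
    (envLaw ν).real (C ∩ {w | ∀ v ∈ S, shift v w ∈ A v})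
      = (envLaw ν).real C * ∏ v ∈ S, (envLaw ν).real (A v) := by
  simp only [measureReal_def, envLaw_inter_shift ν k S hS hC hA, ENNReal.toReal_mul,
    ENNReal.toReal_prod]

theorem measurableSet_root {s : Set (Set Λ)} (hs : MeasurableSet s) :
    MeasurableSet[sigmaOn {a | a.length < 1}] {w : List Λ → Set Λ | w [] ∈ s} :=
  measurable_eval_sigmaOn (S := {a : List Λ | a.length < 1}) (by simp) hs

theorem envLaw_real_root {s : Set (Set Λ)} (hs : MeasurableSet s) :
    (envLaw ν).real {w : List Λ → Set Λ | w [] ∈ s} = ν.real s := by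
  have h := (measurePreserving_eval_infinitePi (fun _ : List Λ => ν) []).measure_preimage
    hs.nullMeasurableSet
  rw [measureReal_def, measureReal_def, ← h]
  rfl

/-- The probability that the letter `i` is an offspring. -/
noncomputable def letterProb (i : Λ) : ℝ := ν.real {s | i ∈ s}

/-- The probability that the word `v` is in the tree. -/
noncomputable def wordProb (v : List Λ) : ℝ := (envLaw ν).real {w | InTree w v}

/-- The probability that both words `u` and `v` are in the tree. -/
noncomputable def pairProb (u v : List Λ) : ℝ :=
  (envLaw ν).real {w | InTree w u ∧ InTree w v}

theorem letterProb_nonneg (i : Λ) : 0 ≤ letterProb ν i := measureReal_nonneg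
theorem wordProb_nonneg (v : List Λ) : 0 ≤ wordProb ν v := measureReal_nonneg
theorem pairProb_nonneg (u v : List Λ) : 0 ≤ pairProb ν u v := measureReal_nonneg

theorem measurableSet_inTree_and (u v : List Λ) :
    MeasurableSet {w : List Λ → Set Λ | InTree w u ∧ InTree w v} :=
  (measurableSet_inTree u).inter (measurableSet_inTree v)

@[simp] theorem wordProb_nil : wordProb ν [] = 1 := by
  simp [wordProb]

@[simp] theorem pairProb_nil : pairProb ν [] [] = 1 := by
  simp [pairProb]

theorem pairProb_cons_self (i : Λ) (a b : List Λ) :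
    pairProb ν (i :: a) (i :: b) = letterProb ν i * pairProb ν a b := by
  have h := envLaw_real_inter_shift ν 1 {[i]} (by simp) (measurableSet_root (measurableSet_mem i))
    (A := fun _ => {w | InTree w a ∧ InTree w b}) (fun _ _ => measurableSet_inTree_and a b)
  rw [envLaw_real_root ν (measurableSet_mem i), Finset.prod_singleton] at h
  rw [pairProb, letterProb, pairProb, ← h]
  congr 1
  ext w
  simp only [inTree_cons, Set.mem_ofPred_eq, Set.mem_inter_iff, Finset.mem_singleton,
    forall_eq]
  tauto

theorem wordProb_cons (i : Λ) (a : List Λ) :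
    wordProb ν (i :: a) = letterProb ν i * wordProb ν a := by
  have h := pairProb_cons_self ν i a a
  simpa [pairProb, wordProb] using h

theorem wordProb_pos (hpos : ∀ i : Λ, 0 < letterProb ν i) (v : List Λ) : 0 < wordProb ν v := by
  induction v with
  | nil => simp
  | cons i v ih =>
    rw [wordProb_cons]
    exact mul_pos (hpos i) ih

/-- The condition at the root is dropped; what remains concerns two disjoint subtrees. This avoids
any assumption on the correlation of `i` and `j` within one offspring set. -/
theorem pairProb_cons_le {i j : Λ} (hij : i ≠ j) (a b : List Λ) :
    pairProb ν (i :: a) (j :: b) ≤ wordProb ν a * wordProb ν b := by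
  classical
  have h := envLaw_real_inter_shift ν 1 {[i], [j]} (by simp) (C := Set.univ) MeasurableSet.univ
    (A := fun v => if v = [i] then {w | InTree w a} else {w | InTree w b})
    (fun v _ => by split_ifs <;> exact measurableSet_inTree _)
  rw [Finset.prod_pair (by simpa using hij), probReal_univ, one_mul, if_pos rfl,
    if_neg (by simpa using hij.symm)] at h
  rw [wordProb, wordProb, ← h]
  refine measureReal_mono fun w hw => ?_
  simp only [inTree_cons, Set.mem_ofPred_eq] at hw
  simp only [Set.univ_inter, Set.mem_ofPred_eq, Finset.mem_insert, Finset.mem_singleton,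
    forall_eq_or_imp, forall_eq, if_true]
  rw [if_neg (by simpa using hij.symm)]
  exact ⟨hw.1.2, hw.2.2⟩

variable (r : Λ → ℝ)

/-- The product of the ratios of the letters of a word. -/
def wordRatio (v : List Λ) : ℝ := (v.map r).prod

@[simp] theorem wordRatio_nil : wordRatio r [] = 1 := by simp [wordRatio]
@[simp] theorem wordRatio_cons (i : Λ) (v : List Λ) :
    wordRatio r (i :: v) = r i * wordRatio r v := by simp [wordRatio]
theorem wordRatio_append (u v : List Λ) :
    wordRatio r (u ++ v) = wordRatio r u * wordRatio r v := by simp [wordRatio]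

variable {r}

theorem wordRatio_pos (hr : ∀ i, 0 < r i) (v : List Λ) : 0 < wordRatio r v :=
  List.prod_pos (by simpa using fun i _ => hr i)

theorem wordRatio_le_pow (hr : ∀ i, 0 < r i) {c : ℝ} (hc : ∀ i, r i ≤ c) (v : List Λ) :
    wordRatio r v ≤ c ^ v.length := by
  induction v with
  | nil => simp
  | cons i v ih =>
    rw [wordRatio_cons, List.length_cons, pow_succ']
    exact mul_le_mul (hc i) ih (wordRatio_pos hr v).le ((hr i).le.trans (hc i))

variable [Fintype Λ] [DecidableEq Λ]

/-- The left side is the expected sum of `r_v ^ t` over level `k` of the tree. At `t = δ` it equals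
1 for every `k`, the constant mean of the branching martingale. -/
theorem sum_wordProb_mul_rpow (hr : ∀ i, 0 < r i) (t : ℝ) (k : ℕ) :
    ∑ v ∈ words Λ k, wordProb ν v * wordRatio r v ^ t
      = (∑ i, letterProb ν i * r i ^ t) ^ k := by
  induction k with
  | zero => simp [words]
  | succ k ih =>
    rw [sum_words_succ, pow_succ', ← ih, Finset.sum_mul]
    refine Finset.sum_congr rfl fun i _ => ?_
    rw [Finset.mul_sum]
    refine Finset.sum_congr rfl fun v _ => ?_
    rw [wordProb_cons, wordRatio_cons, Real.mul_rpow (hr i).le (wordRatio_pos hr v).le]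
    ring

/-- This is the `L²` bound for the branching martingale. Splitting pairs by their first letters
gives `F (k + 1) ≤ b + θ F k`, where `θ = ∑ p_i r_i ^ (2δ) < 1` because every ratio is below 1 and
`δ > 0`. -/
theorem exists_pairProb_bound (hr : ∀ i, 0 < r i) (hr1 : ∀ i, r i < 1)
    (hp : ∀ i, 0 < letterProb ν i) {δ : ℝ}
    (hδ0 : 0 < δ) (hδ : ∑ i, letterProb ν i * r i ^ δ = 1) :
    ∃ C : ℝ, 0 < C ∧ ∀ k, ∑ u ∈ words Λ k, ∑ v ∈ words Λ k,
      pairProb ν u v * (wordRatio r u ^ δ * wordRatio r v ^ δ) ≤ C := by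
  set θ : ℝ := ∑ i, letterProb ν i * (r i ^ δ * r i ^ δ) with hθ
  set b : ℝ := ∑ i, ∑ j, r i ^ δ * r j ^ δ with hb
  have hrδ : ∀ i, 0 < r i ^ δ := fun i => Real.rpow_pos_of_pos (hr i) δ
  have hne : (Finset.univ : Finset Λ).Nonempty := by
    by_contra h
    rw [Finset.not_nonempty_iff_eq_empty] at h
    simp [h] at hδ
  have hθ1 : θ < 1 := by
    rw [hθ, ← hδ]
    refine Finset.sum_lt_sum_of_nonempty hne fun i _ => ?_
    have := Real.rpow_lt_one (hr i).le (hr1 i) hδ0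
    have := hp i
    have := hrδ i
    gcongr
    nlinarith
  have hθ0 : 0 ≤ θ := Finset.sum_nonneg fun i _ =>
    mul_nonneg (letterProb_nonneg ν i) (mul_pos (hrδ i) (hrδ i)).le
  have hb0 : 0 ≤ b := Finset.sum_nonneg fun i _ => Finset.sum_nonneg fun j _ =>
    (mul_pos (hrδ i) (hrδ j)).le
  set F : ℕ → ℝ := fun k => ∑ u ∈ words Λ k, ∑ v ∈ words Λ k,
      pairProb ν u v * (wordRatio r u ^ δ * wordRatio r v ^ δ) with hF
  have hF0 : F 0 = 1 := by simp [hF, words]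
  have hstep : ∀ k, F (k + 1) ≤ b + θ * F k := by
    intro k
    have h1 : F (k + 1) = ∑ i, ∑ j, ∑ u ∈ words Λ k, ∑ v ∈ words Λ k,
        pairProb ν (i :: u) (j :: v)
          * (wordRatio r (i :: u) ^ δ * wordRatio r (j :: v) ^ δ) := by
      simp only [hF]
      rw [sum_words_succ]
      refine Finset.sum_congr rfl fun i _ => ?_
      rw [Finset.sum_comm]
      rw [sum_words_succ]
      refine Finset.sum_congr rfl fun j _ => ?_
      rw [Finset.sum_comm]
    -- For distinct letters the double sum factors into two first moments, both equal to 1. The term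
    -- `r i ^ δ * r j ^ δ` is superfluous on the diagonal and is kept there so that one bound serves
    -- all pairs.
    have h2 : ∀ i j, ∑ u ∈ words Λ k, ∑ v ∈ words Λ k, pairProb ν (i :: u) (j :: v)
          * (wordRatio r (i :: u) ^ δ * wordRatio r (j :: v) ^ δ)
        ≤ r i ^ δ * r j ^ δ
          + if i = j then letterProb ν i * (r i ^ δ * r i ^ δ) * F k else 0 := by
      intro i j
      have hpos := mul_pos (hrδ i) (hrδ j)
      split_ifs with hij
      · subst hij
        have : ∑ u ∈ words Λ k, ∑ v ∈ words Λ k, pairProb ν (i :: u) (i :: v)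
          * (wordRatio r (i :: u) ^ δ * wordRatio r (i :: v) ^ δ)
            = letterProb ν i * (r i ^ δ * r i ^ δ) * F k := by
          simp only [hF, Finset.mul_sum]
          refine Finset.sum_congr rfl fun u _ => Finset.sum_congr rfl fun v _ => ?_
          rw [pairProb_cons_self, wordRatio_cons, wordRatio_cons,
            Real.mul_rpow (hr i).le (wordRatio_pos hr _).le,
            Real.mul_rpow (hr i).le (wordRatio_pos hr _).le]
          ring
        rw [this]
        linarith
      · have hone : ∑ u ∈ words Λ k, wordProb ν u * wordRatio r u ^ δ = 1 := by
          rw [sum_wordProb_mul_rpow ν hr, hδ, one_pow]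
        calc _ ≤ ∑ u ∈ words Λ k, ∑ v ∈ words Λ k, r i ^ δ * r j ^ δ *
              ((wordProb ν u * wordRatio r u ^ δ) * (wordProb ν v * wordRatio r v ^ δ)) := by
              refine Finset.sum_le_sum fun u _ => Finset.sum_le_sum fun v _ => ?_
              rw [wordRatio_cons, wordRatio_cons,
                Real.mul_rpow (hr i).le (wordRatio_pos hr _).le,
                Real.mul_rpow (hr j).le (wordRatio_pos hr _).le]
              have hu := Real.rpow_pos_of_pos (wordRatio_pos hr u) δ
              have hv := Real.rpow_pos_of_pos (wordRatio_pos hr v) δ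
              have h3 := mul_le_mul_of_nonneg_right (pairProb_cons_le ν hij u v)
                (mul_pos hpos (mul_pos hu hv)).le
              calc _ = pairProb ν (i :: u) (j :: v)
                    * (r i ^ δ * r j ^ δ * (wordRatio r u ^ δ * wordRatio r v ^ δ)) := by ring
                _ ≤ _ := h3
                _ = _ := by ring
          _ = r i ^ δ * r j ^ δ := by
              simp only [← Finset.mul_sum, hone, mul_one]
          _ ≤ _ := by linarith
    rw [h1]
    calc _ ≤ ∑ i, ∑ j, (r i ^ δ * r j ^ δ
          + if i = j then letterProb ν i * (r i ^ δ * r i ^ δ) * F k else 0) :=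
          Finset.sum_le_sum fun i _ => Finset.sum_le_sum fun j _ => h2 i j
      _ = b + θ * F k := by
          simp only [Finset.sum_add_distrib, Finset.sum_ite_eq, Finset.mem_univ, if_true, hb, hθ,
            Finset.sum_mul]
  -- The number `b / (1 - θ)` is the fixed point of `x ↦ b + θ x`; the added 1 accommodates `F 0 =
  -- 1`.
  refine ⟨1 + b / (1 - θ), by have := sub_pos.2 hθ1; positivity, fun k => ?_⟩
  have h1θ := sub_pos.2 hθ1
  change F k ≤ _
  induction k with
  | zero =>
    rw [hF0]
    have : 0 ≤ b / (1 - θ) := by positivity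
    linarith
  | succ k ih =>
    refine (hstep k).trans ?_
    have h4 : b / (1 - θ) * (1 - θ) = b := div_mul_cancel₀ b h1θ.ne'
    have := mul_le_mul_of_nonneg_left ih hθ0
    nlinarith

theorem integral_ncard_eq : ∫ s : Set Λ, (s.ncard : ℝ) ∂ν = ∑ i, letterProb ν i := by
  have h : ∀ s : Set Λ, (s.ncard : ℝ) = ∑ i, Set.indicator {s : Set Λ | i ∈ s} 1 s := by
    intro s
    classical
    rw [Set.ncard_eq_toFinset_card']
    simp [Set.indicator_apply, Finset.sum_boole, Set.toFinset]
  simp_rw [h]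
  rw [integral_finsetSum]
  · refine Finset.sum_congr rfl fun i _ => ?_
    rw [integral_indicator_one (measurableSet_mem i)]
    rfl
  · intro i _
    exact (integrable_const (1 : ℝ)).indicator (measurableSet_mem i)

/-- The sum is continuous in the exponent, exceeds 1 at 0 by supercriticality and tends to 0 at
infinity. Supercriticality is also what makes `δ` positive. -/
theorem exists_dimension (hr : ∀ i, 0 < r i) (hr1 : ∀ i, r i < 1)
    (hsuper : 1 < ∑ i, letterProb ν i) :
    ∃ δ : ℝ, 0 < δ ∧ ∑ i, letterProb ν i * r i ^ δ = 1 := by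
  set g : ℝ → ℝ := fun t => ∑ i, letterProb ν i * r i ^ t with hg
  have hcont : Continuous g := by
    refine continuous_finsetSum _ fun i _ => continuous_const.mul ?_
    exact Real.continuous_const_rpow (hr i).ne'
  have hlim : Tendsto g atTop (𝓝 0) := by
    have : Tendsto g atTop (𝓝 (∑ i : Λ, letterProb ν i * 0)) := by
      refine tendsto_finsetSum _ fun i _ => Tendsto.const_mul _ ?_
      exact tendsto_rpow_atTop_of_base_lt_one _ (by linarith [hr i]) (hr1 i)
    simpa using this
  obtain ⟨T, hT⟩ := ((hlim.eventually_lt_const zero_lt_one).and (eventually_gt_atTop 0)).exists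
  have h0 : g 0 = ∑ i, letterProb ν i := by simp [hg]
  obtain ⟨δ, hδ, hδ1⟩ := intermediate_value_Icc' hT.2.le hcont.continuousOn
    (show (1 : ℝ) ∈ Set.Icc (g T) (g 0) from ⟨hT.1.le, by rw [h0]; exact hsuper.le⟩)
  refine ⟨δ, lt_of_le_of_ne hδ.1 ?_, hδ1⟩
  rintro rfl
  rw [h0] at hδ1
  linarith

end Moments

/-! ### The zero-one law -/

section ZeroOne

/-- Let `f x = ∑ c_i x ^ n_i`. If `e < b < 1`, then `b` lies strictly between the points `e` and
`1`, both fixed by `f`, and strict convexity gives `f b < b`. -/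
theorem eq_of_le_genFun {ι : Type*} [Fintype ι] (c : ι → ℝ) (n : ι → ℕ) (hc : ∀ i, 0 ≤ c i)
    (hc1 : ∑ i, c i = 1) (hn : 1 < ∑ i, c i * n i) {e b : ℝ} (he : 0 ≤ e) (heb : e ≤ b)
    (hb : b < 1) (hfe : ∑ i, c i * e ^ n i = e) (hfb : b ≤ ∑ i, c i * b ^ n i) : b = e := by
  by_contra hne
  have hlt : e < b := lt_of_le_of_ne heb (Ne.symm hne)
  -- The mean exceeds 1 only to supply an exponent at least 2 of positive weight, hence strict
  -- convexity.
  obtain ⟨j, hj, hj2⟩ : ∃ j, 0 < c j ∧ 2 ≤ n j := by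
    by_contra! hcon
    refine absurd hn (not_lt.2 ?_)
    rw [← hc1]
    refine Finset.sum_le_sum fun i _ => ?_
    rcases (hc i).eq_or_lt with h | h
    · simp [← h]
    · have : (n i : ℝ) ≤ 1 := by exact_mod_cast Nat.lt_succ_iff.1 (hcon i h)
      nlinarith
  have h1e : 0 < 1 - e := by linarith
  set l : ℝ := (1 - b) / (1 - e) with hl
  have hl0 : 0 < l := div_pos (by linarith) h1e
  have hl1 : l < 1 := (div_lt_one h1e).2 (by linarith)
  have hbl : b = l * e + (1 - l) * 1 := by
    have : l * (1 - e) = 1 - b := div_mul_cancel₀ _ h1e.ne'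
    linarith
  have hconv : ∀ m : ℕ, b ^ m ≤ l * e ^ m + (1 - l) := by
    intro m
    have h := (convexOn_pow m).2 (Set.mem_Ici.2 he)
      (Set.mem_Ici.2 zero_le_one) hl0.le (sub_pos.2 hl1).le (by ring)
    simp only [smul_eq_mul, one_pow] at h
    rw [← hbl] at h
    linarith
  have hstrict : b ^ n j < l * e ^ n j + (1 - l) := by
    have h := (strictConvexOn_pow hj2).2 (Set.mem_Ici.2 he)
      (Set.mem_Ici.2 zero_le_one) (by linarith) hl0 (sub_pos.2 hl1) (by ring)
    simp only [smul_eq_mul, one_pow] at h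
    rw [← hbl] at h
    linarith
  have : ∑ i, c i * b ^ n i < ∑ i, c i * (l * e ^ n i + (1 - l)) :=
    Finset.sum_lt_sum (fun i _ => mul_le_mul_of_nonneg_left (hconv _) (hc i))
      ⟨j, Finset.mem_univ j, mul_lt_mul_of_pos_left hstrict hj⟩
  have h2 : ∑ i, c i * (l * e ^ n i + (1 - l)) = b := by
    calc _ = l * ∑ i, c i * e ^ n i + (1 - l) * ∑ i, c i := by
          simp only [Finset.mul_sum, ← Finset.sum_add_distrib]
          exact Finset.sum_congr rfl fun i _ => by ring
      _ = b := by rw [hfe, hc1, ← hbl]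
  linarith

variable {Λ : Type*} [Finite Λ] (ν : Measure (Set Λ)) [IsProbabilityMeasure ν]

/-- Decompose by the value of the root's offspring set; given it, the subtrees of the children are
independent. The right side is the generating function of `|W|` at the probability of `A`. -/
theorem envLaw_real_forall_children [Fintype (Set Λ)] {A : Set (List Λ → Set Λ)}
    (hA : MeasurableSet A) :
    (envLaw ν).real {w | ∀ i ∈ w [], shift [i] w ∈ A}
      = ∑ s : Set Λ, ν.real {s} * (envLaw ν).real A ^ s.ncard := by
  classical
  have hset : {w : List Λ → Set Λ | ∀ i ∈ w [], shift [i] w ∈ A}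
      = ⋃ s ∈ (Finset.univ : Finset (Set Λ)), ({w : List Λ → Set Λ | w [] ∈ ({s} : Set (Set Λ))}
        ∩ {w | ∀ v ∈ s.toFinite.toFinset.image (fun i => [i]), shift v w ∈ A}) := by
    ext w
    simp
  rw [hset, measureReal_biUnion_finset]
  · refine Finset.sum_congr rfl fun s _ => ?_
    rw [envLaw_real_inter_shift ν 1 _ (by simp) (measurableSet_root (measurableSet_singleton s))
      (A := fun _ => A) (fun _ _ => hA), envLaw_real_root ν (measurableSet_singleton s),
      Finset.prod_const, Finset.card_image_of_injective _ (by intro i j h; simpa using h),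
      Set.ncard_eq_toFinset_card s s.toFinite]
  · intro s _ t _ hst
    refine Set.disjoint_left.2 fun w h1 h2 => hst ?_
    have h3 : w [] = s := h1.1
    have h4 : w [] = t := h2.1
    rw [← h3, h4]
  · intro s _
    refine MeasurableSet.inter (sigmaOn_le _ _ (measurableSet_root (measurableSet_singleton s))) ?_
    have : {w : List Λ → Set Λ | ∀ v ∈ s.toFinite.toFinset.image (fun i => [i]), shift v w ∈ A}
        = ⋂ v ∈ s.toFinite.toFinset.image (fun i => [i]), shift v ⁻¹' A := by
      ext w
      simp
    rw [this]
    exact Finset.measurableSet_biInter _ fun v _ => measurable_shift v hA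

/-- A form of König's lemma. If the subtree of every child dies out, finiteness of the alphabet
gives a common height by which all of them are extinct. -/
theorem not_survives_iff (w : List Λ → Set Λ) :
    ¬ Survives w ↔ ∀ i ∈ w [], ¬ Survives (shift [i] w) := by
  constructor
  · intro h i hi hs
    refine h ((survives_iff w).2 fun n => ?_)
    cases n with
    | zero => exact ⟨[], rfl, inTree_nil w⟩
    | succ n =>
      obtain ⟨v, hv, hT⟩ := (survives_iff _).1 hs n
      exact ⟨i :: v, by simp [hv], (inTree_cons w i v).2 ⟨hi, hT⟩⟩
  · intro h hs
    have h' : ∀ i, i ∈ w [] → ∃ n, ∀ v : List Λ, v.length = n → ¬ InTree (shift [i] w) v := by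
      intro i hi
      have := h i hi
      rw [survives_iff] at this
      push Not at this
      exact this
    cases nonempty_fintype Λ
    choose! n hn using h'
    obtain ⟨v, hv, hT⟩ := (survives_iff w).1 hs (Finset.univ.sup n + 1)
    cases v with
    | nil => simp at hv
    | cons i v =>
      rw [inTree_cons] at hT
      have hl : n i ≤ v.length := by
        have := Finset.le_sup (f := n) (Finset.mem_univ i)
        simp only [List.length_cons, Nat.add_right_cancel_iff] at hv
        omega
      have h3 := hT.2
      rw [← List.take_append_drop (n i) v, inTree_append] at h3
      exact hn i hT.1 (v.take (n i)) (by simp [hl]) h3.1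

/-- If survival is implied by an event `H` of positive probability, then almost surely on survival
`H` is seen from some word of the tree. -/
theorem ae_survives_imp_exists_shift_mem [Fintype Λ]
    (hsuper : 1 < ∫ s : Set Λ, (s.ncard : ℝ) ∂ν) {H : Set (List Λ → Set Λ)} (hH : MeasurableSet H)
    (hpos : envLaw ν H ≠ 0) (hsurv : ∀ w ∈ H, Survives w) :
    ∀ᵐ w ∂envLaw ν, Survives w → ∃ v, InTree w v ∧ shift v w ∈ H := by
  classical
  let _ : Fintype (Set Λ) := Fintype.ofFinite _
  -- `B` is the event that `H` is never seen, `X` is extinction. Both are tested against the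
  -- generating function `f` of `|W|`: the probability of `X` is a fixed point, that of `B`
  -- satisfies `b ≤ f b` and is below 1 since `B` misses `H`. So the two agree, and `B` is
  -- extinction up to a null set.
  set B : Set (List Λ → Set Λ) := {w | ∀ v, InTree w v → shift v w ∉ H} with hB
  set X : Set (List Λ → Set Λ) := {w | ¬ Survives w} with hX
  have hXm : MeasurableSet X := measurableSet_survives.compl
  have hBm : MeasurableSet B := by
    have : B = ⋂ v : List Λ, ({w | InTree w v}ᶜ ∪ (shift v ⁻¹' H)ᶜ) := by
      ext w
      simp only [hB, Set.mem_ofPred_eq, Set.mem_iInter, Set.mem_union, Set.mem_compl_iff,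
        Set.mem_preimage]
      exact forall_congr' fun v => imp_iff_not_or
    rw [this]
    exact MeasurableSet.iInter fun v =>
      (measurableSet_inTree v).compl.union (measurable_shift v hH).compl
  have hXB : X ⊆ B := by
    intro w hw v hv hvH
    refine hw ((survives_iff w).2 fun n => ?_)
    obtain ⟨u, hu, hT⟩ := (survives_iff _).1 (hsurv _ hvH) n
    have hvu : InTree w (v ++ u) := (inTree_append w v u).2 ⟨hv, hT⟩
    rw [← List.take_append_drop n (v ++ u), inTree_append] at hvu
    exact ⟨_, by simp [hu], hvu.1⟩
  have hBchild : B ⊆ {w | ∀ i ∈ w [], shift [i] w ∈ B} := by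
    intro w hw i hi v hv
    rw [shift_shift]
    exact hw _ ((inTree_append w [i] v).2 ⟨(inTree_singleton w i).2 hi, hv⟩)
  have hXchild : X = {w | ∀ i ∈ w [], shift [i] w ∈ X} := by
    ext w
    exact not_survives_iff w
  have hBH : B ⊆ Hᶜ := fun w hw => hw [] (inTree_nil w)
  have hint : ∫ s : Set Λ, (s.ncard : ℝ) ∂ν = ∑ s : Set Λ, ν.real {s} * s.ncard := by
    rw [integral_fintype (Integrable.of_finite)]
    simp
  have hb1 : (envLaw ν).real B < 1 := by
    have h1 : (envLaw ν).real B ≤ (envLaw ν).real Hᶜ := measureReal_mono hBH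
    rw [probReal_compl_eq_one_sub hH] at h1
    have : 0 < (envLaw ν).real H := by
      rw [measureReal_def]
      exact ENNReal.toReal_pos hpos (measure_ne_top _ _)
    linarith
  have hsum1 : ∑ s : Set Λ, ν.real {s} = 1 := by
    rw [sum_measureReal_singleton]
    simp
  have key : (envLaw ν).real B = (envLaw ν).real X := by
    refine eq_of_le_genFun (fun s : Set Λ => ν.real {s}) (fun s => s.ncard)
      (fun _ => measureReal_nonneg) hsum1 ?_ measureReal_nonneg (measureReal_mono hXB) hb1 ?_ ?_
    · rw [← hint]
      exact hsuper
    · rw [← envLaw_real_forall_children ν hXm, ← hXchild]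
    · rw [← envLaw_real_forall_children ν hBm]
      exact measureReal_mono hBchild
  have hdiff : envLaw ν (B \ X) = 0 := by
    have h := measureReal_sdiff hXB hXm (μ := envLaw ν)
    rw [key, sub_self] at h
    exact (measureReal_eq_zero_iff).1 h
  rw [ae_iff]
  refine measure_mono_null (fun w hw => ?_) hdiff
  simp only [Set.mem_ofPred_eq] at hw
  push Not at hw
  exact ⟨fun v hv => hw.2 v hv, fun h => h hw.1⟩

end ZeroOne

/-! ### Counting occurring events -/

section PaleyZygmund

/-- Let `Z` count the occurring events. Cauchy–Schwarz is replaced by the pointwise bound `Z ≤ e/2 +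
(l/2) Z² + 1_G/(2l)`: off `G` one has `Z < e/2`, on `G` it is the inequality of arithmetic and
geometric means. -/
theorem paley_zygmund_card {Ω ι : Type*} [MeasurableSpace Ω] (μ : Measure Ω)
    [IsProbabilityMeasure μ] (V : Finset ι) (A : ι → Set Ω) (hA : ∀ v ∈ V, MeasurableSet (A v))
    {G : Set Ω} (hG : MeasurableSet G) {e q : ℝ} (he : ∑ v ∈ V, μ.real (A v) = e)
    (hq : ∑ u ∈ V, ∑ v ∈ V, μ.real (A u ∩ A v) ≤ q) (he0 : 0 < e) (hq0 : 0 < q)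
    (hGA : ∀ w, e / 2 ≤ ∑ v ∈ V, (A v).indicator (1 : Ω → ℝ) w → w ∈ G) :
    e ^ 2 / (4 * q) ≤ μ.real G := by
  set Z : Ω → ℝ := fun w => ∑ v ∈ V, (A v).indicator (1 : Ω → ℝ) w with hZ
  set Z2 : Ω → ℝ := fun w => ∑ u ∈ V, ∑ v ∈ V, (A u ∩ A v).indicator (1 : Ω → ℝ) w with hZ2
  have hZZ : ∀ w, Z2 w = Z w ^ 2 := by
    intro w
    simp only [hZ, hZ2, sq, Finset.sum_mul_sum, Set.inter_indicator_one, Pi.mul_apply]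
  have hint1 : ∀ s : Set Ω, MeasurableSet s → Integrable (s.indicator (1 : Ω → ℝ)) μ :=
    fun s hs => (integrable_const (1 : ℝ)).indicator hs
  have hZi : Integrable Z μ := integrable_finsetSum _ fun v hv => hint1 _ (hA v hv)
  have hZ2i : Integrable Z2 μ := integrable_finsetSum _ fun u hu =>
    integrable_finsetSum _ fun v hv => hint1 _ ((hA u hu).inter (hA v hv))
  have hZe : ∫ w, Z w ∂μ = e := by
    rw [← he, integral_finsetSum _ fun v hv => hint1 _ (hA v hv)]
    exact Finset.sum_congr rfl fun v hv => integral_indicator_one (hA v hv)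
  have hZ2q : ∫ w, Z2 w ∂μ ≤ q := by
    refine le_trans (le_of_eq ?_) hq
    rw [integral_finsetSum _ fun u hu =>
      integrable_finsetSum _ fun v hv => hint1 _ ((hA u hu).inter (hA v hv))]
    refine Finset.sum_congr rfl fun u hu => ?_
    rw [integral_finsetSum _ fun v hv => hint1 _ ((hA u hu).inter (hA v hv))]
    exact Finset.sum_congr rfl fun v hv => integral_indicator_one ((hA u hu).inter (hA v hv))
  -- With this `l` the quadratic term has mean at most `e/4`, which leaves `e/4 ≤ (q/e) μ(G)`.
  set l : ℝ := e / (2 * q) with hl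
  have hl0 : 0 < l := by positivity
  have hpt : ∀ w, Z w ≤ e / 2 + (l / 2 * Z2 w + 1 / (2 * l) * G.indicator (1 : Ω → ℝ) w) := by
    intro w
    rw [hZZ]
    by_cases hw : w ∈ G
    · rw [Set.indicator_of_mem hw, Pi.one_apply, mul_one]
      have h1 : l / 2 * Z w ^ 2 + 1 / (2 * l) - Z w = (l * Z w - 1) ^ 2 / (2 * l) := by
        field_simp
        ring
      have h2 : 0 ≤ (l * Z w - 1) ^ 2 / (2 * l) := by positivity
      linarith
    · have h1 : Z w < e / 2 := lt_of_not_ge fun h => hw (hGA w h)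
      rw [Set.indicator_of_notMem hw]
      have h2 : 0 ≤ l / 2 * Z w ^ 2 := by positivity
      linarith
  have hi : Integrable (fun w => l / 2 * Z2 w + 1 / (2 * l) * G.indicator (1 : Ω → ℝ) w) μ :=
    (hZ2i.const_mul (l / 2)).add ((hint1 G hG).const_mul (1 / (2 * l)))
  have hmono := integral_mono hZi ((integrable_const (e / 2)).add hi) hpt
  have hcalc : ∫ w, (e / 2 + (l / 2 * Z2 w + 1 / (2 * l) * G.indicator (1 : Ω → ℝ) w)) ∂μ
      = e / 2 + (l / 2 * ∫ w, Z2 w ∂μ + 1 / (2 * l) * μ.real G) := by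
    rw [integral_add (integrable_const _) hi, integral_add (hZ2i.const_mul (l / 2))
      ((hint1 G hG).const_mul (1 / (2 * l))), integral_const_mul, integral_const_mul,
      integral_indicator_one hG, integral_const, probReal_univ, one_smul]
  rw [hZe] at hmono
  replace hmono := hmono.trans_eq hcalc
  have h3 : l / 2 * ∫ w, Z2 w ∂μ ≤ e / 4 := by
    calc _ ≤ l / 2 * q := by gcongr
      _ = e / 4 := by rw [hl]; field_simp; ring
  have h4 : 1 / (2 * l) = q / e := by rw [hl]; field_simp
  rw [h4] at hmono
  have h5 : e / 4 ≤ q / e * μ.real G := by linarith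
  rw [div_le_iff₀ (by positivity)]
  have h6 : q / e * μ.real G * e = q * μ.real G := by field_simp
  nlinarith

end PaleyZygmund

/-! ### Trees with many children in prescribed blocks -/

section Core

variable {Λ : Type*}

/-- All the words of `B` are in the tree and the subtrees rooted there belong to `A`. -/
def blockEvent (B : Finset (List Λ)) (A : Set (List Λ → Set Λ)) : Set (List Λ → Set Λ) :=
  {w | ∀ b ∈ B, InTree w b ∧ shift b w ∈ A}

/-- `M` of the words in `V` are in the tree and have subtrees in `blockEvent B A`. -/
def coreStep (V B : Finset (List Λ)) (M : ℕ) (A : Set (List Λ → Set Λ)) :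
    Set (List Λ → Set Λ) :=
  {w | ∃ S ⊆ V, S.card = M ∧ ∀ v ∈ S, InTree w v ∧ shift v w ∈ blockEvent B A}

/-- The environments in which `coreStep` can be iterated `n` times. -/
def coreSet (V B : Finset (List Λ)) (M : ℕ) : ℕ → Set (List Λ → Set Λ)
  | 0 => Set.univ
  | n + 1 => coreStep V B M (coreSet V B M n)

variable {V B : Finset (List Λ)} {M : ℕ}

theorem measurableSet_blockEvent {A : Set (List Λ → Set Λ)} (hA : MeasurableSet A) :
    MeasurableSet (blockEvent B A) := by
  have : blockEvent B A = ⋂ b ∈ B, ({w | InTree w b} ∩ shift b ⁻¹' A) := by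
    ext w
    simp [blockEvent]
  rw [this]
  exact Finset.measurableSet_biInter _ fun b _ =>
    (measurableSet_inTree b).inter (measurable_shift b hA)

theorem measurableSet_coreStep {A : Set (List Λ → Set Λ)} (hA : MeasurableSet A) :
    MeasurableSet (coreStep V B M A) := by
  classical
  have : coreStep V B M A = ⋃ S ∈ V.powersetCard M, ⋂ v ∈ S,
      ({w | InTree w v} ∩ shift v ⁻¹' blockEvent B A) := by
    ext w
    simp [coreStep, Finset.mem_powersetCard, and_assoc]
  rw [this]
  exact Finset.measurableSet_biUnion _ fun S _ => Finset.measurableSet_biInter _ fun v _ =>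
    (measurableSet_inTree v).inter (measurable_shift v (measurableSet_blockEvent hA))

theorem measurableSet_coreSet (n : ℕ) : MeasurableSet (coreSet V B M n) := by
  induction n with
  | zero => exact MeasurableSet.univ
  | succ n ih => exact measurableSet_coreStep ih

theorem coreStep_mono {A A' : Set (List Λ → Set Λ)} (h : A ⊆ A') :
    coreStep V B M A ⊆ coreStep V B M A' := by
  rintro w ⟨S, hS, hc, hw⟩
  exact ⟨S, hS, hc, fun v hv => ⟨(hw v hv).1, fun b hb =>
    ⟨((hw v hv).2 b hb).1, h ((hw v hv).2 b hb).2⟩⟩⟩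

theorem coreSet_antitone : Antitone (coreSet V B M) := by
  refine antitone_nat_of_succ_le fun n => ?_
  induction n with
  | zero => exact Set.subset_univ _
  | succ n ih => exact coreStep_mono ih

/-- Each depth `n` supplies its own selection `S n`. Since `V` has finitely many subsets, one
selection serves infinitely many depths, hence all of them by monotonicity. -/
theorem exists_subset_of_mem_iInter_coreSet {w : List Λ → Set Λ}
    (hw : w ∈ ⋂ n, coreSet V B M n) :
    ∃ S ⊆ V, S.card = M ∧ ∀ v ∈ S, InTree w v ∧ ∀ b ∈ B, InTree (shift v w) b ∧
      shift (v ++ b) w ∈ ⋂ n, coreSet V B M n := by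
  rw [Set.mem_iInter] at hw
  have h : ∀ n, ∃ S : {S // S ∈ V.powerset}, S.1.card = M ∧ ∀ v ∈ S.1, InTree w v ∧
      shift v w ∈ blockEvent B (coreSet V B M n) := by
    intro n
    obtain ⟨S, hS, hc, h⟩ := hw (n + 1)
    exact ⟨⟨S, Finset.mem_powerset.2 hS⟩, hc, h⟩
  choose S hS hSw using h
  obtain ⟨T, hT⟩ := Finite.exists_infinite_fiber S
  rw [Set.infinite_coe_iff] at hT
  have hlarge : ∀ m, ∃ n, m ≤ n ∧ S n = T := by
    intro m
    obtain ⟨n, hn, hmn⟩ := hT.exists_gt m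
    exact ⟨n, hmn.le, hn⟩
  obtain ⟨n0, -, hn0⟩ := hlarge 0
  refine ⟨T.1, Finset.mem_powerset.1 T.2, hn0 ▸ hS n0, fun v hv => ?_⟩
  refine ⟨(hSw n0 v (hn0 ▸ hv)).1, fun b hb => ⟨((hSw n0 v (hn0 ▸ hv)).2 b hb).1, ?_⟩⟩
  rw [Set.mem_iInter]
  intro m
  obtain ⟨n, hmn, hn⟩ := hlarge m
  rw [← shift_shift]
  exact coreSet_antitone hmn ((hSw n v (hn ▸ hv)).2 b hb).2

variable (ν : Measure (Set Λ)) [IsProbabilityMeasure ν]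

theorem envLaw_real_blockEvent {n : ℕ} (hB : ∀ b ∈ B, b.length = n)
    {A : Set (List Λ → Set Λ)} (hA : MeasurableSet A) :
    (envLaw ν).real (blockEvent B A)
      = (envLaw ν).real {w | ∀ b ∈ B, InTree w b} * (envLaw ν).real A ^ B.card := by
  have hC : MeasurableSet[sigmaOn {a | a.length < n}]
      {w : List Λ → Set Λ | ∀ b ∈ B, InTree w b} := by
    have : {w : List Λ → Set Λ | ∀ b ∈ B, InTree w b} = ⋂ b ∈ B, {w | InTree w b} := by
      ext w
      simp
    rw [this]
    exact Finset.measurableSet_biInter _ fun b hb => measurableSet_inTree_sigmaOn (hB b hb).le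
  have h := envLaw_real_inter_shift ν n B hB hC (A := fun _ => A) fun _ _ => hA
  rw [Finset.prod_const] at h
  rw [← h]
  congr 1
  ext w
  simp [blockEvent, forall_and]

/-- Second moment method for the number of `v ∈ V` that lie in the tree with the block event below
them; its mean is `e g`. Off the diagonal the subtrees are independent and contribute at most `c (e
g)²`; the diagonal contributes `e g ≤ (e g)²`. The resulting bound does not involve `A`, which is
what allows iteration. -/
theorem le_envLaw_real_coreStep {k : ℕ} (hV : ∀ v ∈ V, v.length = k)
    {A : Set (List Λ → Set Λ)} (hA : MeasurableSet A) {e c : ℝ}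
    (he : ∑ v ∈ V, wordProb ν v = e) (hc0 : 0 ≤ c)
    (hc : ∑ u ∈ V, ∑ v ∈ V, pairProb ν u v ≤ c * e ^ 2) (hM : 1 ≤ M)
    (hMg : (M : ℝ) ≤ e * (envLaw ν).real (blockEvent B A) / 2) :
    1 / (4 * (c + 1)) ≤ (envLaw ν).real (coreStep V B M A) := by
  classical
  set g := (envLaw ν).real (blockEvent B A) with hg
  have hg0 : 0 ≤ g := measureReal_nonneg
  have hM1 : (1 : ℝ) ≤ M := by exact_mod_cast hM
  have heg : 1 ≤ e * g := by linarith
  have hbm : MeasurableSet (blockEvent B A) := measurableSet_blockEvent hA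
  set D : List Λ → Set (List Λ → Set Λ) := fun v => {w | InTree w v} ∩ shift v ⁻¹' blockEvent B A
    with hD
  have hDm : ∀ v ∈ V, MeasurableSet (D v) := fun v _ =>
    (measurableSet_inTree v).inter (measurable_shift v hbm)
  have hD1 : ∀ v ∈ V, (envLaw ν).real (D v) = wordProb ν v * g := by
    intro v hv
    have h := envLaw_real_inter_shift ν k {v} (by simpa using hV v hv)
      (measurableSet_inTree_sigmaOn (hV v hv).le) (A := fun _ => blockEvent B A)
      (fun _ _ => hbm)
    rw [Finset.prod_singleton] at h
    rw [wordProb, hg, ← h]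
    congr 1
    ext w
    simp [hD]
  have hD2 : ∀ u ∈ V, ∀ v ∈ V, u ≠ v →
      (envLaw ν).real (D u ∩ D v) = pairProb ν u v * g ^ 2 := by
    intro u hu v hv huv
    have h := envLaw_real_inter_shift ν k {u, v} (by simp [hV u hu, hV v hv])
      (C := {w | InTree w u} ∩ {w | InTree w v})
      (MeasurableSet.inter (measurableSet_inTree_sigmaOn (hV u hu).le)
        (measurableSet_inTree_sigmaOn (hV v hv).le)) (A := fun _ => blockEvent B A)
      (fun _ _ => hbm)
    rw [Finset.prod_pair huv] at h
    rw [pairProb, hg, sq, Set.ofPred_and, ← h]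
    congr 1
    ext w
    simp only [hD, Set.mem_inter_iff, Set.mem_ofPred_eq, Set.mem_preimage, Finset.mem_insert,
      Finset.mem_singleton, forall_eq_or_imp, forall_eq]
    tauto
  have hsum1 : ∑ v ∈ V, (envLaw ν).real (D v) = e * g := by
    rw [← he, Finset.sum_mul]
    exact Finset.sum_congr rfl hD1
  have hsum2 : ∑ u ∈ V, ∑ v ∈ V, (envLaw ν).real (D u ∩ D v) ≤ (c + 1) * (e * g) ^ 2 := by
    calc _ ≤ ∑ u ∈ V, ∑ v ∈ V, (pairProb ν u v * g ^ 2
            + if u = v then wordProb ν u * g else 0) := by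
          refine Finset.sum_le_sum fun u hu => Finset.sum_le_sum fun v hv => ?_
          split_ifs with huv
          · subst huv
            rw [Set.inter_self, hD1 u hu]
            have := pairProb_nonneg ν u u
            nlinarith [mul_nonneg this (sq_nonneg g)]
          · rw [hD2 u hu v hv huv, add_zero]
      _ = (∑ u ∈ V, ∑ v ∈ V, pairProb ν u v) * g ^ 2 + e * g := by
          simp only [Finset.sum_add_distrib, Finset.sum_mul, ← he]
          congr 1
          refine Finset.sum_congr rfl fun u hu => ?_
          rw [Finset.sum_ite_eq]
          simp [hu]
      _ ≤ (c * e ^ 2) * g ^ 2 + (e * g) ^ 2 := by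
          gcongr
          nlinarith
      _ = _ := by ring
  have h := paley_zygmund_card (envLaw ν) V D hDm (measurableSet_coreStep hA (M := M)) hsum1 hsum2
    (by linarith) (by positivity) (fun w hw => by
      have hcard : ∑ v ∈ V, (D v).indicator (1 : (List Λ → Set Λ) → ℝ) w
          = ((V.filter fun v => w ∈ D v).card : ℝ) := by
        rw [Finset.card_filter]
        push_cast
        refine Finset.sum_congr rfl fun v _ => ?_
        by_cases hv : w ∈ D v <;> simp [hv]
      rw [hcard] at hw
      have hMc : M ≤ (V.filter fun v => w ∈ D v).card := by
        exact_mod_cast hMg.trans hw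
      obtain ⟨S, hS, hSc⟩ := Finset.exists_subset_card_eq hMc
      refine ⟨S, hS.trans (Finset.filter_subset _ _), hSc, fun v hv => ?_⟩
      exact (Finset.mem_filter.1 (hS hv)).2)
  refine le_trans (le_of_eq ?_) h
  have hc1 : 0 < 4 * (c + 1) := by linarith
  have heg2 : 0 < (e * g) ^ 2 := by positivity
  rw [div_eq_div_iff hc1.ne' (by positivity)]
  ring

/-- The bound `s = 1 / (4 (c + 1))` reproduces itself: `M` is small enough for a step whose input
event has probability only `s`, and the output again has probability at least `s`. Continuity from
above finishes. -/
theorem envLaw_iInter_coreSet_ne_zero {k n : ℕ} (hV : ∀ v ∈ V, v.length = k)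
    (hB : ∀ b ∈ B, b.length = n) {e c : ℝ}
    (he : ∑ v ∈ V, wordProb ν v = e) (hc0 : 0 ≤ c)
    (hc : ∑ u ∈ V, ∑ v ∈ V, pairProb ν u v ≤ c * e ^ 2) (hM : 1 ≤ M)
    (hMe : (M : ℝ) ≤ e * ((envLaw ν).real {w | ∀ b ∈ B, InTree w b}
      * (1 / (4 * (c + 1))) ^ B.card) / 2) :
    envLaw ν (⋂ n, coreSet V B M n) ≠ 0 := by
  have he0 : 0 ≤ e := he ▸ Finset.sum_nonneg fun v _ => wordProb_nonneg ν v
  have hlow : ∀ n, 1 / (4 * (c + 1)) ≤ (envLaw ν).real (coreSet V B M n) := by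
    intro n
    induction n with
    | zero =>
      rw [coreSet, probReal_univ, div_le_one (by positivity)]
      linarith
    | succ n ih =>
      refine le_envLaw_real_coreStep ν hV (measurableSet_coreSet n) he hc0 hc hM (hMe.trans ?_)
      rw [envLaw_real_blockEvent ν hB (measurableSet_coreSet n)]
      gcongr
  rw [coreSet_antitone.measure_iInter (fun n => (measurableSet_coreSet n).nullMeasurableSet)
    ⟨0, measure_ne_top _ _⟩]
  have hs : 0 < ENNReal.ofReal (1 / (4 * (c + 1))) := ENNReal.ofReal_pos.2 (by positivity)
  refine (hs.trans_le (le_iInf fun n => ?_)).ne'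
  rw [ENNReal.ofReal_le_iff_le_toReal (measure_ne_top _ _)]
  exact hlow n

theorem survives_of_mem_iInter_coreSet {k : ℕ} (hV : ∀ v ∈ V, v.length = k) (hk : 0 < k)
    (hM : 1 ≤ M) (hBne : B.Nonempty) {w : List Λ → Set Λ} (hw : w ∈ ⋂ n, coreSet V B M n) :
    Survives w := by
  have key : ∀ m, ∀ w ∈ ⋂ n, coreSet V B M n, ∃ v : List Λ, m ≤ v.length ∧ InTree w v := by
    intro m
    induction m with
    | zero => exact fun w _ => ⟨[], by simp, inTree_nil w⟩
    | succ m ih =>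
      intro w hw
      obtain ⟨S, hS, hc, h⟩ := exists_subset_of_mem_iInter_coreSet hw
      obtain ⟨v, hv⟩ : S.Nonempty := Finset.card_pos.1 (by omega)
      obtain ⟨b, hb⟩ := hBne
      obtain ⟨h1, h2⟩ := h v hv
      obtain ⟨h3, h4⟩ := h2 b hb
      obtain ⟨u, hu, hT⟩ := ih _ h4
      refine ⟨v ++ b ++ u, ?_, ?_⟩
      · have := hV v (hS hv)
        simp only [List.length_append]
        omega
      · rw [inTree_append, inTree_append]
        exact ⟨⟨h1, h3⟩, hT⟩
  refine (survives_iff w).2 fun n => ?_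
  obtain ⟨v, hv, hT⟩ := key n w hw
  rw [← List.take_append_drop n v, inTree_append] at hT
  exact ⟨_, by simp [hv], hT.1⟩

end Core

/-! ### Choice of the parameters -/

section Parameters

theorem eventually_mul_pow_le_pow (A : ℝ) (m : ℕ) {a : ℝ} (ha : 1 < a) :
    ∀ᶠ k : ℕ in atTop, A * ((k : ℝ) + 1) ^ m ≤ a ^ k := by
  have h := (tendsto_pow_const_div_const_pow_of_one_lt m ha).comp (tendsto_add_atTop_nat 1)
  have h2 := h.const_mul (A * a)
  rw [mul_zero] at h2
  filter_upwards [h2.eventually_lt_const zero_lt_one] with k hk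
  have ha0 : 0 < a := by linarith
  simp only [Function.comp_apply, Nat.cast_add, Nat.cast_one] at hk
  rw [pow_succ, ← mul_div_assoc, div_lt_one (by positivity)] at hk
  nlinarith

variable {Λ : Type*} [Fintype Λ] [DecidableEq Λ] (ν : Measure (Set Λ)) [IsProbabilityMeasure ν]
  {r : Λ → ℝ}

theorem wordRatio_eq_of_perm {u v : List Λ} (h : u.Perm v) : wordRatio r u = wordRatio r v :=
  (h.map r).prod_eq

/-- Among the words of length `k` there is a class of words with the same ratio that carries a
polynomially small part of the expected `δ`-mass. -/
theorem exists_homogeneous_words (hr : ∀ i, 0 < r i) {δ : ℝ}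
    (hδ : ∑ i, letterProb ν i * r i ^ δ = 1) (k : ℕ) :
    ∃ (V : Finset (List Λ)) (R : ℝ), V ⊆ words Λ k ∧ V.Nonempty ∧ (∀ v ∈ V, wordRatio r v = R) ∧
      1 ≤ ((k : ℝ) + 1) ^ Fintype.card Λ * ((∑ v ∈ V, wordProb ν v) * R ^ δ) := by
  have hsum := sum_wordProb_mul_rpow ν hr δ k
  rw [hδ, one_pow] at hsum
  -- Words are grouped by letter counts. There are at most `(k + 1) ^ |Λ|` groups, the ratio is
  -- constant on each, and the total mass is 1, so some group carries at least the average.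
  set P : Finset (Λ → ℕ) := Fintype.piFinset fun _ => Finset.range (k + 1) with hP
  have hPc : P.card = (k + 1) ^ Fintype.card Λ := by simp [hP]
  have hmaps : ∀ v ∈ words Λ k, (fun i => v.count i) ∈ P := by
    intro v hv
    rw [mem_words] at hv
    simp only [hP, Fintype.mem_piFinset, Finset.mem_range]
    intro i
    have := List.count_le_length (a := i) (l := v)
    omega
  have hPne : P.Nonempty := by
    rw [← Finset.card_pos, hPc]
    positivity
  rw [← Finset.sum_fiberwise_of_maps_to hmaps] at hsum
  obtain ⟨τ, hτ, hle⟩ := Finset.exists_le_of_sum_le (s := P)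
    (f := fun _ => 1 / ((k : ℝ) + 1) ^ Fintype.card Λ)
    (g := fun τ => ∑ v ∈ words Λ k with (fun i => v.count i) = τ,
      wordProb ν v * wordRatio r v ^ δ) hPne (by
        rw [hsum, Finset.sum_const, hPc, nsmul_eq_mul]
        push_cast
        rw [mul_one_div_cancel (by positivity)])
  set V : Finset (List Λ) := {v ∈ words Λ k | (fun i => v.count i) = τ} with hVdef
  have hVne : V.Nonempty := by
    by_contra hcon
    rw [Finset.not_nonempty_iff_eq_empty] at hcon
    rw [hcon, Finset.sum_empty] at hle
    have : 0 < 1 / ((k : ℝ) + 1) ^ Fintype.card Λ := by positivity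
    linarith
  obtain ⟨v₀, hv₀⟩ := hVne
  have hratio : ∀ v ∈ V, wordRatio r v = wordRatio r v₀ := by
    intro v hv
    refine wordRatio_eq_of_perm (List.perm_iff_count.2 fun i => ?_)
    have h1 := (Finset.mem_filter.1 hv).2
    have h2 := (Finset.mem_filter.1 hv₀).2
    exact congrFun (h1.trans h2.symm) i
  refine ⟨V, wordRatio r v₀, Finset.filter_subset _ _, ⟨v₀, hv₀⟩, hratio, ?_⟩
  have h2 : ∑ v ∈ V, wordProb ν v * wordRatio r v ^ δ
      = (∑ v ∈ V, wordProb ν v) * wordRatio r v₀ ^ δ := by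
    rw [Finset.sum_mul]
    exact Finset.sum_congr rfl fun v hv => by rw [hratio v hv]
  rw [h2, div_le_iff₀ (by positivity)] at hle
  linarith

/-- An event of positive probability on which the tree contains a homogeneous subtree with many
children, arranged in blocks. -/
theorem exists_core (hr : ∀ i, 0 < r i) (hr1 : ∀ i, r i < 1) (hp : ∀ i, 0 < letterProb ν i)
    {δ : ℝ} (hδ0 : 0 < δ) (hδ : ∑ i, letterProb ν i * r i ^ δ = 1)
    {B : Finset (List Λ)} (hBne : B.Nonempty) {n : ℕ} (hBn : ∀ b ∈ B, b.length = n) {ρ : ℝ}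
    (hρ0 : 0 < ρ) (hρ1 : ρ ≤ 1)
    (hBp : 0 < (envLaw ν).real {w | ∀ b ∈ B, InTree w b})
    {t t' : ℝ} (ht : 0 < t) (htt' : t < t') (ht' : t' < δ) :
    ∃ (k : ℕ) (R : ℝ) (V : Finset (List Λ)) (M : ℕ), 0 < k ∧ 0 < R ∧ R < 1 ∧ 2 ≤ M ∧
      (∀ v ∈ V, v.length = k ∧ wordRatio r v = R) ∧
      (R * ρ) ^ (-t) ≤ (M * B.card : ℕ) ∧ ((M * B.card : ℕ) : ℝ) ≤ (R * ρ) ^ (-t') ∧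
      envLaw ν (⋂ m, coreSet V B M m) ≠ 0 := by
  obtain ⟨C, hC0, hC⟩ := exists_pairProb_bound ν hr hr1 hp hδ0 hδ
  set L := Fintype.card Λ with hL
  set ℓ := B.card with hℓ
  have hℓ1 : (1 : ℝ) ≤ ℓ := by exact_mod_cast Finset.card_pos.2 hBne
  set p₀ := (envLaw ν).real {w | ∀ b ∈ B, InTree w b} with hp₀
  obtain ⟨c, hc0, hc1, hrc⟩ : ∃ c : ℝ, 0 < c ∧ c < 1 ∧ ∀ i, r i ≤ c := by
    have hne : Nonempty Λ := by
      by_contra h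
      rw [not_nonempty_iff] at h
      simp at hδ
    obtain ⟨i, hi⟩ := Finite.exists_max r
    exact ⟨r i, hr i, hr1 i, hi⟩
  have hpow : ∀ x : ℝ, 0 < x → 1 < c ^ (-x) := fun x hx =>
    Real.one_lt_rpow_of_pos_of_lt_one_of_neg hc0 hc1 (by linarith)
  -- The power of `k + 1` collects one factor `P` lost in choosing the class and `P ^ (2ℓ)` from the
  -- iterated probability raised to the power `ℓ`. It must be beaten by the gap `R ^ (-(δ - t))`,
  -- and `R ≤ c ^ k`. The next line makes room for the factor `2ℓ` between the exponents `t` and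
  -- `t'`.
  have hev1 := eventually_mul_pow_le_pow (4 * ρ ^ (-t) * (4 * (C + 1)) ^ ℓ / p₀)
    (L + 2 * L * ℓ) (hpow (δ - t) (by linarith))
  have hev2 := eventually_mul_pow_le_pow (2 * ℓ) 0 (hpow (t' - t) (by linarith))
  obtain ⟨k, ⟨hk1, hk2⟩, hk0⟩ := ((hev1.and hev2).and (eventually_gt_atTop 0)).exists
  obtain ⟨V, R, hVk, hVne, hVR, hVsum⟩ := exists_homogeneous_words ν hr hδ k
  set P : ℝ := ((k : ℝ) + 1) ^ L with hP
  have hP1 : 1 ≤ P := one_le_pow₀ (by linarith [Nat.cast_nonneg (α := ℝ) k])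
  obtain ⟨v₀, hv₀⟩ := hVne
  have hlen : ∀ v ∈ V, v.length = k := fun v hv => mem_words.1 (hVk hv)
  have hR0 : 0 < R := hVR v₀ hv₀ ▸ wordRatio_pos hr v₀
  have hRc : R ≤ c ^ k := by
    rw [← hVR v₀ hv₀, ← hlen v₀ hv₀]
    exact wordRatio_le_pow hr hrc v₀
  have hR1 : R < 1 := hRc.trans_lt (pow_lt_one₀ hc0.le hc1 hk0.ne')
  have hRx : ∀ x : ℝ, 0 < x → (c ^ (-x)) ^ k ≤ R ^ (-x) := by
    intro x hx
    rw [← Real.rpow_mul_natCast hc0.le, mul_comm, Real.rpow_natCast_mul hc0.le]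
    exact Real.rpow_le_rpow_of_nonpos hR0 hRc (by linarith)
  set e := ∑ v ∈ V, wordProb ν v with he
  have heR : R ^ (-δ) ≤ P * e := by
    rw [Real.rpow_neg hR0.le, inv_le_iff_one_le_mul₀ (Real.rpow_pos_of_pos hR0 δ)]
    linarith
  -- On `V` all weights equal `R ^ δ`, so the uniform bound `C` on the weighted sum becomes a
  -- multiple of `e ^ 2` through `1 ≤ P * (e * R ^ δ)`.
  have hQ : ∑ u ∈ V, ∑ v ∈ V, pairProb ν u v ≤ (C * P ^ 2) * e ^ 2 := by
    have h1 : (∑ u ∈ V, ∑ v ∈ V, pairProb ν u v) * (R ^ δ * R ^ δ) ≤ C := by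
      refine le_trans ?_ (hC k)
      calc _ = ∑ u ∈ V, ∑ v ∈ V, pairProb ν u v * (wordRatio r u ^ δ * wordRatio r v ^ δ) := by
            simp only [Finset.sum_mul]
            exact Finset.sum_congr rfl fun u hu => Finset.sum_congr rfl fun v hv => by
              rw [hVR u hu, hVR v hv]
        _ ≤ ∑ u ∈ words Λ k, ∑ v ∈ V,
              pairProb ν u v * (wordRatio r u ^ δ * wordRatio r v ^ δ) := by
            refine Finset.sum_le_sum_of_subset_of_nonneg hVk fun u _ _ => ?_
            refine Finset.sum_nonneg fun v _ => mul_nonneg (pairProb_nonneg ν u v) ?_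
            have := wordRatio_pos hr u
            have := wordRatio_pos hr v
            positivity
        _ ≤ _ := by
            refine Finset.sum_le_sum fun u _ => ?_
            refine Finset.sum_le_sum_of_subset_of_nonneg hVk fun v _ _ => ?_
            have := wordRatio_pos hr u
            have := wordRatio_pos hr v
            have := pairProb_nonneg ν u v
            positivity
    have h2 : 1 ≤ P * (e * R ^ δ) := hVsum
    have hRδ := Real.rpow_pos_of_pos hR0 δ
    have h3 : 1 ≤ (P * (e * R ^ δ)) ^ 2 := one_le_pow₀ h2
    have h4 : (∑ u ∈ V, ∑ v ∈ V, pairProb ν u v) * (R ^ δ * R ^ δ)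
        ≤ (C * P ^ 2 * e ^ 2) * (R ^ δ * R ^ δ) := by
      calc _ ≤ C * 1 := by linarith
        _ ≤ C * (P * (e * R ^ δ)) ^ 2 := by gcongr
        _ = _ := by ring
    exact le_of_mul_le_mul_right h4 (by positivity)
  have hRρ0 : 0 < R * ρ := mul_pos hR0 hρ0
  have hRρ1 : R * ρ < 1 := by nlinarith
  set y := (R * ρ) ^ (-t) with hy
  have hy1 : 1 < y := Real.one_lt_rpow_of_pos_of_lt_one_of_neg hRρ0 hRρ1 (by linarith)
  -- Since `y > 1`, rounding up gives both `M ≥ 2` and `M ≤ 2 y`.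
  set M := ⌈y⌉₊ with hM
  have hMy : y ≤ M := Nat.le_ceil y
  have hM2 : 2 ≤ M := by
    have : (1 : ℝ) < M := hy1.trans_le hMy
    exact_mod_cast this
  have hMle : (M : ℝ) ≤ 2 * y := by
    have := (Nat.ceil_lt_add_one (by linarith : (0 : ℝ) ≤ y)).le
    linarith
  refine ⟨k, R, V, M, hk0, hR0, hR1, hM2, fun v hv => ⟨hlen v hv, hVR v hv⟩, ?_, ?_, ?_⟩
  · push_cast
    nlinarith
  · have h1 : (2 * ℓ : ℝ) ≤ (R * ρ) ^ (-(t' - t)) := by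
      have h2 := hRx (t' - t) (by linarith)
      rw [pow_zero, mul_one] at hk2
      refine hk2.trans (h2.trans ?_)
      exact Real.rpow_le_rpow_of_nonpos hRρ0 (by nlinarith) (by linarith)
    have h3 : (R * ρ) ^ (-t') = (R * ρ) ^ (-(t' - t)) * y := by
      rw [hy, ← Real.rpow_add hRρ0]
      congr 1
      ring
    rw [h3]
    push_cast
    calc (M : ℝ) * ℓ ≤ 2 * y * ℓ := by gcongr
      _ = 2 * ℓ * y := by ring
      _ ≤ _ := by gcongr
  · refine envLaw_iInter_coreSet_ne_zero ν hlen hBn he.symm (c := C * P ^ 2) (by positivity) hQ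
      (by omega) ?_
    have hs : (1 / (4 * (C + 1) * P ^ 2)) ^ ℓ ≤ (1 / (4 * (C * P ^ 2 + 1))) ^ ℓ := by
      have hP2 : 1 ≤ P ^ 2 := one_le_pow₀ hP1
      refine pow_le_pow_left₀ (by positivity) (one_div_le_one_div_of_le (by positivity) ?_) _
      nlinarith
    have he0 : 0 ≤ e := Finset.sum_nonneg fun v _ => wordProb_nonneg ν v
    have h1 : 4 * y * P * (4 * (C + 1) * P ^ 2) ^ ℓ / p₀ ≤ P * e := by
      refine le_trans ?_ heR
      have h2 : R ^ (-δ) = R ^ (-(δ - t)) * R ^ (-t) := by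
        rw [← Real.rpow_add hR0]
        congr 1
        ring
      have h3 := hk1.trans (hRx (δ - t) (by linarith))
      have h4 : ((k : ℝ) + 1) ^ (L + 2 * L * ℓ) = P * (P ^ 2) ^ ℓ := by
        rw [hP, ← pow_mul, ← pow_mul, ← pow_add]
        congr 1
        ring
      rw [h4] at h3
      have hRt := Real.rpow_pos_of_pos hR0 (-t)
      rw [h2, hy, Real.mul_rpow hR0.le hρ0.le, mul_pow]
      calc _ = 4 * ρ ^ (-t) * (4 * (C + 1)) ^ ℓ / p₀ * (P * (P ^ 2) ^ ℓ) * R ^ (-t) := by ring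
        _ ≤ _ := by gcongr
    have hP0 : 0 < P := by linarith
    have h5 : 4 * y * (4 * (C + 1) * P ^ 2) ^ ℓ ≤ e * p₀ := by
      rw [div_le_iff₀ hBp] at h1
      refine le_of_mul_le_mul_left ?_ hP0
      linarith
    have h6 : 4 * y ≤ e * p₀ * (1 / (4 * (C + 1) * P ^ 2)) ^ ℓ := by
      rw [one_div, inv_pow, ← div_eq_mul_inv, le_div_iff₀ (by positivity)]
      exact h5
    calc (M : ℝ) ≤ 2 * y := hMle
      _ ≤ e * p₀ * (1 / (4 * (C + 1) * P ^ 2)) ^ ℓ / 2 := by linarith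
      _ ≤ e * p₀ * (1 / (4 * (C * P ^ 2 + 1))) ^ ℓ / 2 := by gcongr
      _ = _ := by ring

end Parameters

/-! ### Similarities and iterated function systems -/

section Similarity

variable {d : ℕ}

/-- Division by `r` gives an isometry, which is affine because the space is strictly convex and onto
because the dimensions agree. -/
theorem exists_affineEquiv_of_similarity {f : Euc d → Euc d} {r : ℝ} (hr : 0 < r)
    (hf : ∀ x y, dist (f x) (f y) = r * dist x y) : ∃ e : Euc d ≃ᵃ[ℝ] Euc d, ∀ x, e x = f x := by
  have hi : Isometry fun x => r⁻¹ • f x := by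
    refine Isometry.of_dist_eq fun x y => ?_
    rw [dist_smul₀, hf, Real.norm_of_nonneg (inv_nonneg.2 hr.le), inv_mul_cancel_left₀ hr.ne']
  refine ⟨(hi.affineIsometryOfStrictConvexSpace.toAffineIsometryEquiv rfl).toAffineEquiv.trans
    (LinearEquiv.smulOfNeZero ℝ (Euc d) r hr.ne').toAffineEquiv, fun x => ?_⟩
  change r • (r⁻¹ • f x) = f x
  rw [smul_inv_smul₀ hr.ne']

theorem IsHyperplane.exists_preimage {f : Euc d → Euc d} {r : ℝ} (hr : 0 < r)
    (hf : ∀ x y, dist (f x) (f y) = r * dist x y) {L : AffineSubspace ℝ (Euc d)}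
    (hL : IsHyperplane L) : ∃ L' : AffineSubspace ℝ (Euc d), IsHyperplane L' ∧
      ∀ (ε : ℝ) (x : Euc d), f x ∈ Metric.thickening (r * ε) (L : Set (Euc d)) →
        x ∈ Metric.thickening ε (L' : Set (Euc d)) := by
  obtain ⟨e, he⟩ := exists_affineEquiv_of_similarity hr hf
  refine ⟨L.map (e.symm : Euc d →ᵃ[ℝ] Euc d), ⟨?_, ?_⟩, fun ε x hx => ?_⟩
  · rw [AffineSubspace.coe_map]
    exact hL.1.image _
  · rw [AffineSubspace.map_direction, AffineEquiv.linear_toAffineMap,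
      LinearEquiv.finrank_map_eq]
    exact hL.2
  · rw [Metric.mem_thickening_iff] at hx ⊢
    obtain ⟨z, hz, hxz⟩ := hx
    refine ⟨e.symm z, ⟨z, hz, rfl⟩, ?_⟩
    have h := hf x (e.symm z)
    rw [← he (e.symm z), e.apply_symm_apply] at h
    rw [h] at hxz
    exact lt_of_mul_lt_mul_left hxz hr.le

/-! ### Cylinders, spread and the open set condition -/

namespace SimilarityIFS

variable {Λ : Type*} (Φ : SimilarityIFS d Λ)

/-- The contraction ratio of the map `φ_i`. -/
noncomputable def ratio (i : Λ) : ℝ := (Φ.isContractingSimilarity i).choose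

theorem ratio_pos (i : Λ) : 0 < Φ.ratio i := (Φ.isContractingSimilarity i).choose_spec.1
theorem ratio_lt_one (i : Λ) : Φ.ratio i < 1 := (Φ.isContractingSimilarity i).choose_spec.2.1
theorem dist_map (i : Λ) (x y : Euc d) : dist (Φ.map i x) (Φ.map i y) = Φ.ratio i * dist x y :=
  (Φ.isContractingSimilarity i).choose_spec.2.2 x y

theorem dist_wordMap (v : List Λ) (x y : Euc d) :
    dist (Φ.wordMap v x) (Φ.wordMap v y) = wordRatio Φ.ratio v * dist x y := by
  induction v with
  | nil => simp [wordMap]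
  | cons i v ih =>
    rw [wordRatio_cons, mul_assoc, ← ih, ← Φ.dist_map]
    rfl

theorem wordRatio_ratio_pos (v : List Λ) : 0 < wordRatio Φ.ratio v := wordRatio_pos Φ.ratio_pos v

theorem wordMap_append (u v : List Λ) (x : Euc d) :
    Φ.wordMap (u ++ v) x = Φ.wordMap u (Φ.wordMap v x) := by
  induction u with
  | nil => rfl
  | cons i u ih =>
    change Φ.map i (Φ.wordMap (u ++ v) x) = Φ.map i (Φ.wordMap u (Φ.wordMap v x))
    rw [ih]

theorem continuous_wordMap (v : List Λ) : Continuous (Φ.wordMap v) := by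
  refine LipschitzWith.continuous (K := (wordRatio Φ.ratio v).toNNReal)
    (LipschitzWith.of_dist_le_mul fun x y => ?_)
  rw [dist_wordMap, Real.coe_toNNReal _ (Φ.wordRatio_ratio_pos v).le]

theorem ball_subset_wordMap_image (v : List Λ) (x : Euc d) (η : ℝ) :
    Metric.ball (Φ.wordMap v x) (wordRatio Φ.ratio v * η) ⊆ Φ.wordMap v '' Metric.ball x η := by
  obtain ⟨e, he⟩ := exists_affineEquiv_of_similarity (Φ.wordRatio_ratio_pos v) (Φ.dist_wordMap v)
  intro y hy
  have h1 : Φ.wordMap v (e.symm y) = y := by rw [← he, e.apply_symm_apply]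
  refine ⟨e.symm y, ?_, h1⟩
  rw [Metric.mem_ball, ← h1, dist_wordMap] at hy
  exact lt_of_mul_lt_mul_left hy (Φ.wordRatio_ratio_pos v).le

theorem wordMap_image_subset {U : Set (Euc d)} (hU : ∀ i, Φ.map i '' U ⊆ U) (v : List Λ) :
    Φ.wordMap v '' U ⊆ U := by
  induction v with
  | nil => simp [wordMap]
  | cons i v ih =>
    rintro _ ⟨x, hx, rfl⟩
    exact hU i ⟨_, ih ⟨x, hx, rfl⟩, rfl⟩

theorem map_injective (i : Λ) : Function.Injective (Φ.map i) := by
  intro x y h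
  have := Φ.dist_map i x y
  rw [h, dist_self] at this
  exact dist_eq_zero.1 ((mul_eq_zero.1 this.symm).resolve_left (Φ.ratio_pos i).ne')

theorem disjoint_wordMap_image {U : Set (Euc d)} (hU : ∀ i, Φ.map i '' U ⊆ U)
    (hdisj : ∀ i j, i ≠ j → Disjoint (Φ.map i '' U) (Φ.map j '' U)) {u v : List Λ}
    (hl : u.length = v.length) (huv : u ≠ v) :
    Disjoint (Φ.wordMap u '' U) (Φ.wordMap v '' U) := by
  induction u generalizing v with
  | nil =>
    cases v with
    | nil => exact absurd rfl huv
    | cons j v => simp at hl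
  | cons i u ih =>
    cases v with
    | nil => simp at hl
    | cons j v =>
      have himg : ∀ (i : Λ) (u : List Λ),
          Φ.wordMap (i :: u) '' U = Φ.map i '' (Φ.wordMap u '' U) := fun i u => by
        rw [wordMap, Set.image_comp]
      rw [himg, himg]
      by_cases hij : i = j
      · subst hij
        rw [Set.disjoint_image_iff (Φ.map_injective i)]
        exact ih (by simpa using hl) fun h => huv (by rw [h])
      · exact (hdisj i j hij).mono (Set.image_mono (Φ.wordMap_image_subset hU u))
          (Set.image_mono (Φ.wordMap_image_subset hU v))

variable [Finite Λ] [Nonempty Λ]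

theorem isCompact_attractor : IsCompact Φ.attractor := Φ.isAttractor_attractor.2.1

theorem attractor_nonempty : Φ.attractor.Nonempty := Φ.isAttractor_attractor.1

theorem wordMap_image_attractor_subset (v : List Λ) :
    Φ.wordMap v '' Φ.attractor ⊆ Φ.attractor := by
  refine Φ.wordMap_image_subset (fun i => ?_) v
  conv_rhs => rw [Φ.isAttractor_attractor.2.2]
  exact Set.subset_iUnion (fun i => Φ.map i '' Φ.attractor) i

/-- The cylinder set `φ_v(K)`. -/
def cylinder (v : List Λ) : Set (Euc d) := Φ.wordMap v '' Φ.attractor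

theorem cylinder_append_subset (u v : List Λ) : Φ.cylinder (u ++ v) ⊆ Φ.cylinder u := by
  rintro _ ⟨x, hx, rfl⟩
  rw [wordMap_append]
  exact ⟨_, Φ.wordMap_image_attractor_subset v ⟨x, hx, rfl⟩, rfl⟩

theorem cylinder_subset_of_prefix {u v : List Λ} (h : u <+: v) : Φ.cylinder v ⊆ Φ.cylinder u := by
  obtain ⟨t, rfl⟩ := h
  exact Φ.cylinder_append_subset u t

theorem isCompact_cylinder (v : List Λ) : IsCompact (Φ.cylinder v) :=
  Φ.isCompact_attractor.image (Φ.continuous_wordMap v)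

theorem cylinder_nonempty (v : List Λ) : (Φ.cylinder v).Nonempty := Φ.attractor_nonempty.image _

theorem dist_le_of_mem_cylinder {v : List Λ} {x y : Euc d} (hx : x ∈ Φ.cylinder v)
    (hy : y ∈ Φ.cylinder v) : dist x y ≤ wordRatio Φ.ratio v * Metric.diam Φ.attractor := by
  obtain ⟨x, hx, rfl⟩ := hx
  obtain ⟨y, hy, rfl⟩ := hy
  rw [dist_wordMap]
  exact mul_le_mul_of_nonneg_left
    (Metric.dist_le_diam_of_mem Φ.isCompact_attractor.isBounded hx hy)
    (Φ.wordRatio_ratio_pos v).le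

theorem ediam_cylinder_le (v : List Λ) : Metric.ediam (Φ.cylinder v)
    ≤ ENNReal.ofReal (wordRatio Φ.ratio v * Metric.diam Φ.attractor) :=
  Metric.ediam_le_of_forall_dist_le fun _ hx _ hy => Φ.dist_le_of_mem_cylinder hx hy

/-- For every hyperplane, one of the cylinders of the words in `B` is at distance at least `ε` from
it. -/
def Spread (ε : ℝ) (B : Set (List Λ)) : Prop :=
  ∀ L : AffineSubspace ℝ (Euc d), IsHyperplane L →
    ∃ b ∈ B, Disjoint (Φ.cylinder b) (Metric.thickening ε (L : Set (Euc d)))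

variable {Φ} in
theorem Spread.append {ε : ℝ} {B : Set (List Λ)} (h : Φ.Spread ε B) (v : List Λ) :
    Φ.Spread (wordRatio Φ.ratio v * ε) ((fun b => v ++ b) '' B) := by
  intro L hL
  obtain ⟨L', hL', hth⟩ := hL.exists_preimage (Φ.wordRatio_ratio_pos v) (Φ.dist_wordMap v)
  obtain ⟨b, hb, hdisj⟩ := h L' hL'
  refine ⟨_, ⟨b, hb, rfl⟩, Set.disjoint_left.2 ?_⟩
  rintro _ ⟨x, hx, rfl⟩ hxL
  rw [wordMap_append] at hxL
  exact Set.disjoint_left.1 hdisj ⟨x, hx, rfl⟩ (hth _ _ hxL)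

variable {Φ} in
/-- A word may be replaced by an extension without destroying spread. -/
theorem Spread.of_prefix {ε : ℝ} {B B' : Set (List Λ)} (h : Φ.Spread ε B)
    (hB : ∀ b ∈ B, ∃ b' ∈ B', b <+: b') : Φ.Spread ε B' := by
  intro L hL
  obtain ⟨b, hb, hdisj⟩ := h L hL
  obtain ⟨b', hb', hp⟩ := hB b hb
  exact ⟨b', hb', hdisj.mono_left (Φ.cylinder_subset_of_prefix hp)⟩

/-- Under the open set condition, the number of cylinders of size at least `s` that meet a ball of
radius `s` is bounded. -/
theorem OpenSetCondition.exists_card_le {Φ : SimilarityIFS d Λ} (h : Φ.OpenSetCondition) :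
    ∃ C : ℝ, 1 ≤ C ∧ ∀ (F : Finset (List Λ)) (n : ℕ) (s : ℝ) (x : Euc d), 0 < s →
      (∀ v ∈ F, v.length = n ∧ wordRatio Φ.ratio v = s ∧
        (Φ.cylinder v ∩ Metric.ball x s).Nonempty) → (F.card : ℝ) ≤ C := by
  obtain ⟨U, hUo, ⟨x₀, hx₀⟩, hU, hdisj⟩ := h
  obtain ⟨η, hη, hball⟩ := Metric.isOpen_iff.1 hUo x₀ hx₀
  obtain ⟨Q, hQ⟩ := (Metric.isBounded_iff_subset_ball x₀).1 Φ.isCompact_attractor.isBounded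
  have hQ0 : 0 < Q := by
    obtain ⟨κ, hκ⟩ := Φ.attractor_nonempty
    exact dist_nonneg.trans_lt (hQ hκ)
  -- Volume comparison: the images of a ball of radius `η` in `U` are disjoint balls of radius `s
  -- η`, all inside the ball of radius `s (1 + Q + η)` about `x`. Disjointness uses that the words
  -- have equal length.
  refine ⟨((1 + Q + η) / η) ^ d, one_le_pow₀ ?_, fun F n s x hs hF => ?_⟩
  · rw [one_le_div hη]
    linarith
  · have hsub : ∀ v ∈ F, Metric.ball (Φ.wordMap v x₀) (s * η)
        ⊆ Metric.ball x (s * (1 + Q + η)) := by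
      intro v hv
      obtain ⟨hl, hr, y, ⟨κ, hκ, rfl⟩, hy⟩ := hF v hv
      refine Metric.ball_subset_ball' ?_
      have h1 : dist (Φ.wordMap v x₀) (Φ.wordMap v κ) ≤ s * Q := by
        rw [dist_wordMap, hr, dist_comm]
        exact mul_le_mul_of_nonneg_left (Metric.mem_ball.1 (hQ hκ)).le hs.le
      have h2 := dist_triangle (Φ.wordMap v x₀) (Φ.wordMap v κ) x
      have h3 := (Metric.mem_ball.1 hy).le
      nlinarith
    have hpair : (F : Set (List Λ)).PairwiseDisjoint
        fun v => Metric.ball (Φ.wordMap v x₀) (s * η) := by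
      intro u hu v hv huv
      have hb : ∀ v ∈ F, Metric.ball (Φ.wordMap v x₀) (s * η) ⊆ Φ.wordMap v '' U := by
        intro v hv
        rw [← (hF v hv).2.1]
        exact (Φ.ball_subset_wordMap_image v x₀ η).trans (Set.image_mono hball)
      exact (Φ.disjoint_wordMap_image hU hdisj ((hF u hu).1.trans (hF v hv).1.symm) huv).mono
        (hb u hu) (hb v hv)
    have hvol : ∑ v ∈ F, volume (Metric.ball (Φ.wordMap v x₀) (s * η))
        ≤ volume (Metric.ball x (s * (1 + Q + η))) := by
      rw [← measure_biUnion_finset hpair fun _ _ => Metric.isOpen_ball.measurableSet]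
      exact measure_mono (Set.iUnion₂_subset hsub)
    have hsη : 0 < s * η := mul_pos hs hη
    have hsQ : 0 < s * (1 + Q + η) := by positivity
    have hone : (volume (Metric.ball (0 : Euc d) 1)).toReal ≠ 0 :=
      (ENNReal.toReal_pos (Metric.measure_ball_pos _ _ zero_lt_one).ne'
        measure_ball_lt_top.ne).ne'
    have hone' : 0 < (volume (Metric.ball (0 : Euc d) 1)).toReal :=
      lt_of_le_of_ne ENNReal.toReal_nonneg hone.symm
    simp only [Measure.addHaar_ball_of_pos volume _ hsη, Measure.addHaar_ball_of_pos volume _ hsQ,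
      Finset.sum_const, nsmul_eq_mul] at hvol
    have hvol' := ENNReal.toReal_mono
      (ENNReal.mul_ne_top ENNReal.ofReal_ne_top measure_ball_lt_top.ne) hvol
    rw [ENNReal.toReal_mul, ENNReal.toReal_mul, ENNReal.toReal_mul, ENNReal.toReal_natCast,
      ENNReal.toReal_ofReal (by positivity), ENNReal.toReal_ofReal (by positivity), ← mul_assoc,
      finrank_euclideanSpace_fin] at hvol'
    have h4 := le_of_mul_le_mul_right hvol' hone'
    rw [div_pow, le_div_iff₀ (by positivity)]
    rw [mul_pow, mul_pow] at h4
    have hsd : 0 < s ^ d := by positivity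
    refine le_of_mul_le_mul_left ?_ hsd
    linarith

end SimilarityIFS

/-- The mass distribution principle for Ahlfors-regular measures. -/
theorem AhlforsRegularMeasure.le_dimH {δ : ℝ} (hδ : 0 < δ) {μ : Measure (Euc d)}
    (hμ : AhlforsRegularMeasure δ μ) (hne : μ ≠ 0) : ENNReal.ofReal δ ≤ dimH μ.support := by
  obtain ⟨c₁, c₂, hc₁, hc₂, hball⟩ := hμ
  have hcover : ∀ s : Set (Euc d), Metric.ediam s ≤ ENNReal.ofReal (1 / 2) →
      μ s ≤ ENNReal.ofReal c₂ * Metric.ediam s ^ δ := by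
    intro s hs
    by_cases hsμ : (s ∩ μ.support).Nonempty
    · obtain ⟨x, hxs, hx⟩ := hsμ
      have htop : Metric.ediam s ≠ ⊤ := (hs.trans_lt ENNReal.ofReal_lt_top).ne
      set η := (Metric.ediam s).toReal with hη
      have hη0 : 0 ≤ η := ENNReal.toReal_nonneg
      have hη1 : η < 1 := by
        have := ENNReal.toReal_mono ENNReal.ofReal_ne_top hs
        rw [ENNReal.toReal_ofReal (by norm_num)] at this
        linarith
      -- Balls are open, so a set of diameter `η` is only known to lie in balls of radius `ϱ > η`;
      -- letting `ϱ` decrease to `η` also covers `η = 0`.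
      have hle : ∀ᶠ ϱ in 𝓝[>] η, μ s ≤ ENNReal.ofReal (c₂ * ϱ ^ δ) := by
        filter_upwards [Ioo_mem_nhdsGT hη1] with ϱ hϱ
        refine le_trans (measure_mono fun y hy => ?_)
          (hball ϱ (hη0.trans_lt hϱ.1) hϱ.2 x hx).2
        rw [Metric.mem_ball]
        have h1 : edist y x ≤ Metric.ediam s := Metric.edist_le_ediam_of_mem hy hxs
        have h2 := ENNReal.toReal_mono htop h1
        rw [edist_dist, ENNReal.toReal_ofReal dist_nonneg] at h2
        exact h2.trans_lt hϱ.1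
      have hlim : Tendsto (fun ϱ : ℝ => ENNReal.ofReal (c₂ * ϱ ^ δ)) (𝓝[>] η)
          (𝓝 (ENNReal.ofReal (c₂ * η ^ δ))) := by
        refine (ENNReal.continuous_ofReal.comp ?_).continuousAt.tendsto.mono_left
          nhdsWithin_le_nhds
        exact continuous_const.mul (Real.continuous_rpow_const hδ.le)
      refine (ge_of_tendsto hlim hle).trans (le_of_eq ?_)
      rw [ENNReal.ofReal_mul hc₂.le, ← ENNReal.ofReal_rpow_of_nonneg hη0 hδ.le, hη,
        ENNReal.ofReal_toReal htop]
    · have : μ s = 0 := by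
        refine measure_mono_null (fun y hy hyμ => hsμ ⟨y, hy, hyμ⟩) (Measure.measure_compl_support)
      rw [this]
      exact zero_le
  have hc0 : ENNReal.ofReal c₂ ≠ 0 := (ENNReal.ofReal_pos.2 hc₂).ne'
  have hle := Measure.le_hausdorffMeasure δ ((ENNReal.ofReal c₂)⁻¹ • μ) (ENNReal.ofReal (1 / 2))
    (ENNReal.ofReal_pos.2 (by norm_num)) fun s hs => by
      rw [Measure.smul_apply, smul_eq_mul]
      calc _ ≤ (ENNReal.ofReal c₂)⁻¹ * (ENNReal.ofReal c₂ * Metric.ediam s ^ δ) := by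
            gcongr
            exact hcover s hs
        _ = _ := ENNReal.inv_mul_cancel_left hc0 ENNReal.ofReal_ne_top
  have hsupp : μ μ.support ≠ 0 := by
    intro h0
    refine hne (Measure.measure_univ_eq_zero.1 ?_)
    rw [← Set.union_compl_self μ.support]
    exact measure_union_null h0 Measure.measure_compl_support
  have hH : Measure.hausdorffMeasure ((⟨δ, hδ.le⟩ : ℝ≥0) : ℝ) μ.support ≠ 0 := by
    intro h0
    have h1 := hle μ.support
    rw [Measure.smul_apply, smul_eq_mul] at h1
    have h2 : Measure.hausdorffMeasure δ μ.support = 0 := h0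
    rw [h2, nonpos_iff_eq_zero, mul_eq_zero] at h1
    exact h1.elim (fun h => ENNReal.ofReal_ne_top (ENNReal.inv_eq_zero.1 h)) hsupp
  have := le_dimH_of_hausdorffMeasure_ne_zero hH
  refine le_trans (le_of_eq ?_) this
  rw [ENNReal.ofReal]
  congr 1
  exact Real.toNNReal_of_nonneg hδ.le

end Similarity

/-! ### Prefixes of infinite words -/

section Prefix

variable {α : Type*}

@[simp] theorem length_prefixWord (x : ℕ → α) (n : ℕ) : (prefixWord x n).length = n := by
  simp [prefixWord]

theorem prefixWord_succ (x : ℕ → α) (n : ℕ) :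
    prefixWord x (n + 1) = prefixWord x n ++ [x n] := by
  rw [prefixWord, List.ofFn_succ_last]
  rfl

theorem prefixWord_congr {x y : ℕ → α} {n : ℕ} (h : ∀ i < n, x i = y i) :
    prefixWord x n = prefixWord y n := by
  unfold prefixWord
  congr 1
  funext i
  exact h i i.2

theorem exists_prefixWord_eq [Nonempty α] (z : List α) :
    ∃ y : ℕ → α, prefixWord y z.length = z := by
  obtain ⟨a⟩ := ‹Nonempty α›
  refine ⟨fun n => z.getD n a, ?_⟩
  refine List.ext_getElem (by simp) fun n h1 h2 => ?_
  simp [prefixWord]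

/-- A growing sequence of words defines an infinite word. -/
theorem exists_prefixWord_of_prefix (u : ℕ → List α) (hu : ∀ n, u n <+: u (n + 1))
    (hl : ∀ n, n ≤ (u n).length) : ∃ x : ℕ → α, ∀ n, prefixWord x n <+: u n := by
  have hmono : ∀ {m n}, m ≤ n → u m <+: u n := by
    intro m n h
    induction n, h using Nat.le_induction with
    | base => exact List.prefix_rfl
    | succ n _ ih => exact ih.trans (hu n)
  refine ⟨fun n => (u (n + 1))[n]'(hl (n + 1)), fun n => ?_⟩
  have : prefixWord (fun n => (u (n + 1))[n]'(hl (n + 1))) n = (u n).take n := by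
    refine List.ext_getElem (by simp [hl]) fun i h1 h2 => ?_
    simp only [prefixWord, List.getElem_ofFn, List.getElem_take]
    have hi : i < n := by simpa using h1
    exact (hmono hi).getElem (hl (i + 1))
  rw [this]
  exact List.take_prefix n (u n)

end Prefix

/-! ### Homogeneous trees of words -/

open SimilarityIFS

/-- A tree of words in which every node has exactly `N` children, whose words are extended by words
of length `m` and ratio `ρ` that are `ε`-spread. -/
structure HomogeneousTree {d : ℕ} {Λ : Type*} [Finite Λ] [Nonempty Λ] (Φ : SimilarityIFS d Λ)
    (N m : ℕ) (ρ ε : ℝ) where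
  node : List (Fin N) → List Λ
  child : List (Fin N) → Fin N → List Λ
  node_append : ∀ z j, node (z ++ [j]) = node z ++ child z j
  child_injective : ∀ z, Function.Injective (child z)
  length_child : ∀ z j, (child z j).length = m
  ratio_child : ∀ z j, wordRatio Φ.ratio (child z j) = ρ
  spread_child : ∀ z, Φ.Spread ε (Set.range (child z))
  two_le : 2 ≤ N
  pos_length : 0 < m
  pos_ratio : 0 < ρ
  ratio_lt_one : ρ < 1
  pos_spread : 0 < ε

namespace HomogeneousTree

variable {d : ℕ} {Λ : Type*} [Finite Λ] [Nonempty Λ] {Φ : SimilarityIFS d Λ} {N m : ℕ} {ρ ε : ℝ}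
  (H : HomogeneousTree Φ N m ρ ε)

include H in
theorem nonempty_fin : Nonempty (Fin N) := ⟨⟨0, by have := H.two_le; omega⟩⟩

/-- The ratio of the root of the tree. -/
noncomputable def rootRatio : ℝ := wordRatio Φ.ratio (H.node [])

theorem rootRatio_pos : 0 < H.rootRatio := Φ.wordRatio_ratio_pos _

theorem length_node (z : List (Fin N)) :
    (H.node z).length = (H.node []).length + m * z.length := by
  induction z using List.reverseRecOn with
  | nil => simp
  | append_singleton z j ih =>
    rw [H.node_append, List.length_append, ih, H.length_child]
    simp [Nat.mul_add, Nat.add_assoc]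

theorem ratio_node (z : List (Fin N)) :
    wordRatio Φ.ratio (H.node z) = H.rootRatio * ρ ^ z.length := by
  induction z using List.reverseRecOn with
  | nil => simp [rootRatio]
  | append_singleton z j ih =>
    rw [H.node_append, wordRatio_append, ih, H.ratio_child, List.length_append,
      List.length_singleton, pow_succ]
    ring

/-- Needed for the mass bound: distinct codes of one depth must give distinct words before the open
set condition can count them. -/
theorem node_injOn {z z' : List (Fin N)} (hl : z.length = z'.length) (h : H.node z = H.node z') :
    z = z' := by
  induction z using List.reverseRecOn generalizing z' with
  | nil => exact (List.length_eq_zero_iff.1 hl.symm).symm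
  | append_singleton z j ih =>
    obtain ⟨y, i, rfl⟩ : ∃ y i, z' = y ++ [i] := by
      rcases List.eq_nil_or_concat z' with rfl | ⟨y, i, rfl⟩
      · simp at hl
      · exact ⟨y, i, by simp⟩
    have hl' : z.length = y.length := by simpa using hl
    rw [H.node_append, H.node_append] at h
    obtain ⟨h1, h2⟩ := List.append_inj h (by rw [H.length_node z, H.length_node y, hl'])
    obtain rfl := ih hl' h1
    rw [H.child_injective _ h2]

/-- The cell of the node `z`. -/
def cell (z : List (Fin N)) : Set (Euc d) := Φ.cylinder (H.node z)

theorem node_prefix_succ (y : ℕ → Fin N) (n : ℕ) :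
    H.node (prefixWord y n) <+: H.node (prefixWord y (n + 1)) := by
  rw [prefixWord_succ, H.node_append]
  exact List.prefix_append _ _

theorem cell_antitone (y : ℕ → Fin N) : Antitone fun n => H.cell (prefixWord y n) :=
  antitone_nat_of_succ_le fun n => Φ.cylinder_subset_of_prefix (H.node_prefix_succ y n)

theorem exists_point (y : ℕ → Fin N) : ∃ x, ∀ n, x ∈ H.cell (prefixWord y n) := by
  have h := IsCompact.nonempty_iInter_of_sequence_nonempty_isCompact_isClosed
    (fun n => H.cell (prefixWord y n)) (fun n => H.cell_antitone y n.le_succ)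
    (fun n => Φ.cylinder_nonempty _) (Φ.isCompact_cylinder _)
    (fun n => (Φ.isCompact_cylinder _).isClosed)
  obtain ⟨x, hx⟩ := h
  exact ⟨x, Set.mem_iInter.1 hx⟩

/-- The coding map of the tree. -/
noncomputable def point (y : ℕ → Fin N) : Euc d := (H.exists_point y).choose

theorem point_mem (y : ℕ → Fin N) (n : ℕ) : H.point y ∈ H.cell (prefixWord y n) :=
  (H.exists_point y).choose_spec n

/-- The set coded by the tree. -/
def carrier : Set (Euc d) := Set.range H.point

/-- A length that exceeds the diameter of the attractor. -/
noncomputable def size (_ : HomogeneousTree Φ N m ρ ε) : ℝ := Metric.diam Φ.attractor + 1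

theorem size_pos : 0 < H.size := add_pos_of_nonneg_of_pos Metric.diam_nonneg one_pos

theorem dist_lt_of_mem_cell {z : List (Fin N)} {x y : Euc d} (hx : x ∈ H.cell z)
    (hy : y ∈ H.cell z) : dist x y < H.size * H.rootRatio * ρ ^ z.length := by
  have h := Φ.dist_le_of_mem_cylinder hx hy
  rw [H.ratio_node] at h
  have := mul_pos H.rootRatio_pos (pow_pos H.pos_ratio z.length)
  refine h.trans_lt ?_
  rw [size]
  nlinarith

theorem dist_point_lt {y y' : ℕ → Fin N} {n : ℕ} (h : ∀ i < n, y i = y' i) :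
    dist (H.point y) (H.point y') < H.size * H.rootRatio * ρ ^ n := by
  have h1 := H.point_mem y' n
  rw [← prefixWord_congr h] at h1
  simpa using H.dist_lt_of_mem_cell (H.point_mem y n) h1

theorem continuous_point : Continuous H.point := by
  rw [continuous_iff_continuousAt]
  intro y
  rw [ContinuousAt, Metric.tendsto_nhds]
  intro η hη
  have hlim : Tendsto (fun n => H.size * H.rootRatio * ρ ^ n) atTop (𝓝 0) := by
    simpa using (tendsto_pow_atTop_nhds_zero_of_lt_one H.pos_ratio.le H.ratio_lt_one).const_mul
      (H.size * H.rootRatio)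
  obtain ⟨n, hn⟩ := (hlim.eventually_lt_const hη).exists
  have hev : ∀ᶠ y' in 𝓝 y, ∀ i ∈ Finset.range n, y' i = y i := by
    rw [Filter.eventually_all_finset]
    intro i _
    exact (continuous_apply i).continuousAt.eventually
      (show ∀ᶠ j in 𝓝 (y i), j = y i by simp)
  filter_upwards [hev] with y' hy'
  exact (H.dist_point_lt fun i hi => hy' i (Finset.mem_range.2 hi)).trans hn

theorem isCompact_carrier : IsCompact H.carrier := isCompact_range H.continuous_point

theorem carrier_nonempty : H.carrier.Nonempty := by
  have := H.nonempty_fin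
  exact Set.range_nonempty _

include H in
/-- Scale selection: `ξ` lies between two consecutive cell sizes. -/
theorem exists_scale {ξ c : ℝ} (hξ : 0 < ξ) (hc : ξ ≤ c) :
    ∃ n, c * ρ ^ (n + 1) < ξ ∧ ξ ≤ c * ρ ^ n := by
  have hc0 : 0 < c := hξ.trans_le hc
  obtain ⟨n, h1, h2⟩ := exists_nat_pow_near_of_lt_one (div_pos hξ hc0) ((div_le_one hc0).2 hc)
    H.pos_ratio H.ratio_lt_one
  refine ⟨n, ?_, ?_⟩
  · rw [lt_div_iff₀ hc0] at h1
    linarith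
  · rw [div_le_iff₀ hc0] at h2
    linarith

/-- With `ξ` between two consecutive cell sizes, the cell of depth `n + 1` around the point fits in
the ball of radius `ξ`, and by spread one of its children avoids a neighborhood of `L` of width
comparable to that cell. The factor `ρ` in `β` is the loss between consecutive scales. -/
theorem hyperplaneDiffuse_carrier : HyperplaneDiffuse H.carrier := by
  have hs := mul_pos H.size_pos H.rootRatio_pos
  refine ⟨ε * ρ / H.size, div_pos (mul_pos H.pos_spread H.pos_ratio) H.size_pos,
    H.isCompact_carrier.isClosed, H.size * H.rootRatio, hs, ?_⟩
  rintro ξ hξ hξ1 _ ⟨y, rfl⟩ L hL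
  obtain ⟨n, hn1, hn2⟩ := H.exists_scale hξ hξ1.le
  obtain ⟨_, ⟨_, ⟨j, rfl⟩, rfl⟩, hdisj⟩ :=
    (H.spread_child (prefixWord y (n + 1))).append (H.node (prefixWord y (n + 1))) L hL
  change Disjoint (Φ.cylinder (H.node (prefixWord y (n + 1)) ++ _)) _ at hdisj
  rw [← H.node_append] at hdisj
  have := H.nonempty_fin
  obtain ⟨y', hy'⟩ := exists_prefixWord_eq (prefixWord y (n + 1) ++ [j])
  rw [List.length_append, length_prefixWord, List.length_singleton] at hy'
  have hmem : H.point y' ∈ H.cell (prefixWord y (n + 1) ++ [j]) := hy' ▸ H.point_mem y' (n + 1 + 1)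
  have hmem' : H.point y' ∈ H.cell (prefixWord y (n + 1)) := by
    have h1 := H.point_mem y' (n + 1)
    rw [prefixWord_succ] at hy'
    rwa [(List.append_inj hy' (by simp)).1] at h1
  refine ⟨H.point y', ⟨⟨y', rfl⟩, ?_⟩, fun hL' => ?_⟩
  · have := H.dist_lt_of_mem_cell hmem' (H.point_mem y (n + 1))
    rw [length_prefixWord] at this
    exact this.trans hn1
  · refine Set.disjoint_left.1 hdisj hmem (Metric.thickening_mono ?_ _ hL')
    rw [H.ratio_node, length_prefixWord]
    calc ε * ρ / H.size * ξ ≤ ε * ρ / H.size * (H.size * H.rootRatio * ρ ^ n) := by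
          have := mul_pos H.pos_spread H.pos_ratio
          have := H.size_pos
          gcongr
      _ = H.rootRatio * ρ ^ (n + 1) * ε := by
          have := H.size_pos.ne'
          field_simp
          ring

/-- Along a code the node words grow by `m > 0` letters each time, so they determine an infinite
word; its prefixes are prefixes of nodes and thus in the tree. -/
theorem carrier_subset_limitSet {w : List Λ → Set Λ} (hw : ∀ z, InTree w (H.node z)) :
    H.carrier ⊆ limitSet Φ w := by
  rintro _ ⟨y, rfl⟩
  obtain ⟨x, hx⟩ := exists_prefixWord_of_prefix (fun n => H.node (prefixWord y n))
    (H.node_prefix_succ y) fun n => by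
      rw [H.length_node, length_prefixWord]
      have := Nat.le_mul_of_pos_left n H.pos_length
      omega
  refine Set.mem_iUnion₂.2 ⟨x, fun n => ?_, Set.mem_iInter.2 fun n => ?_⟩
  · rw [mem_treeLevel_iff]
    refine ⟨length_prefixWord x n, ?_⟩
    obtain ⟨t, ht⟩ := hx n
    have := hw (prefixWord y n)
    rw [← ht, inTree_append] at this
    exact this.1
  · exact Φ.cylinder_subset_of_prefix (hx n) (H.point_mem y n)

theorem carrier_subset_iUnion_cell (n : ℕ) :
    H.carrier ⊆ ⋃ z : Fin n → Fin N, H.cell (List.ofFn z) := by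
  rintro _ ⟨y, rfl⟩
  exact Set.mem_iUnion.2 ⟨fun i => y i, H.point_mem y n⟩

/-- Cover by the `N ^ n` cells of depth `n`: the `s`-sums are at most a constant times `(N ρ ^ s) ^
n`. Overlaps are harmless here. -/
theorem dimH_carrier_le {s : ℝ} (hs : 0 ≤ s) (hN : N * ρ ^ s ≤ 1) :
    dimH H.carrier ≤ ENNReal.ofReal s := by
  set c := H.size * H.rootRatio with hc
  have hc0 : 0 < c := mul_pos H.size_pos H.rootRatio_pos
  have hd : ∀ n (z : Fin n → Fin N),
      Metric.ediam (H.cell (List.ofFn z)) ≤ ENNReal.ofReal (c * ρ ^ n) := by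
    intro n z
    refine Metric.ediam_le_of_forall_dist_le fun x hx y hy => ?_
    simpa using (H.dist_lt_of_mem_cell hx hy).le
  have hlim : Tendsto (fun n => ENNReal.ofReal (c * ρ ^ n)) atTop (𝓝 0) := by
    have := (tendsto_pow_atTop_nhds_zero_of_lt_one H.pos_ratio.le H.ratio_lt_one).const_mul c
    rw [mul_zero] at this
    simpa [Function.comp_def] using (ENNReal.continuous_ofReal.tendsto _).comp this
  have hle := Measure.hausdorffMeasure_le_liminf_sum s H.carrier (l := atTop)
    (fun n => ENNReal.ofReal (c * ρ ^ n)) hlim (fun n (z : Fin n → Fin N) => H.cell (List.ofFn z))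
    (Eventually.of_forall fun n z => hd n z)
    (Eventually.of_forall fun n => H.carrier_subset_iUnion_cell n)
  have hbound : ∀ n, ∑ z : Fin n → Fin N, Metric.ediam (H.cell (List.ofFn z)) ^ s
      ≤ ENNReal.ofReal (c ^ s) := by
    intro n
    have hρn : 0 < ρ ^ n := pow_pos H.pos_ratio n
    calc _ ≤ ∑ z : Fin n → Fin N, ENNReal.ofReal (c * ρ ^ n) ^ s :=
          Finset.sum_le_sum fun z _ => ENNReal.rpow_le_rpow (hd n z) hs
      _ = ENNReal.ofReal ((N * ρ ^ s) ^ n * c ^ s) := by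
          rw [Finset.sum_const, nsmul_eq_mul, ENNReal.ofReal_rpow_of_nonneg (by positivity) hs,
            ← ENNReal.ofReal_natCast, ← ENNReal.ofReal_mul (Nat.cast_nonneg _),
            Real.mul_rpow hc0.le hρn.le, ← Real.rpow_pow_comm H.pos_ratio.le, mul_pow]
          congr 1
          simp
          ring
      _ ≤ ENNReal.ofReal (c ^ s) := by
          have h0 : 0 ≤ N * ρ ^ s := by
            have := H.pos_ratio
            positivity
          have := pow_le_one₀ h0 hN (n := n)
          have hcs : 0 < c ^ s := Real.rpow_pos_of_pos hc0 s
          exact ENNReal.ofReal_le_ofReal (by nlinarith)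
  have hfin : Measure.hausdorffMeasure ((⟨s, hs⟩ : ℝ≥0) : ℝ) H.carrier ≠ ⊤ := by
    refine ((hle.trans ?_).trans_lt (ENNReal.ofReal_lt_top (r := c ^ s))).ne
    exact (liminf_le_liminf (Eventually.of_forall hbound)).trans_eq (liminf_const _)
  refine (dimH_le_of_hausdorffMeasure_ne_top hfin).trans (le_of_eq ?_)
  rw [ENNReal.ofReal]
  congr 1
  exact (Real.toNNReal_of_nonneg hs).symm

/-! ### The uniform measure and Ahlfors regularity -/

/-- The uniform measure on the boundary of the tree. -/
noncomputable def codeMeasure (_ : HomogeneousTree Φ N m ρ ε) : Measure (ℕ → Fin N) :=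
  Measure.infinitePi fun _ => (N : ℝ≥0∞)⁻¹ • Measure.count

include H in
theorem isProbabilityMeasure_uniform :
    IsProbabilityMeasure ((N : ℝ≥0∞)⁻¹ • (Measure.count : Measure (Fin N))) := by
  constructor
  have hN : (N : ℝ≥0∞) ≠ 0 := by
    have := H.two_le
    exact_mod_cast (by omega : N ≠ 0)
  rw [Measure.smul_apply, smul_eq_mul, Measure.count_univ]
  simp [ENNReal.inv_mul_cancel hN]

theorem isProbabilityMeasure_codeMeasure : IsProbabilityMeasure H.codeMeasure := by
  have := H.isProbabilityMeasure_uniform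
  unfold codeMeasure
  infer_instance

theorem codeMeasure_prefix (z : List (Fin N)) :
    H.codeMeasure {y | prefixWord y z.length = z} = (N : ℝ≥0∞)⁻¹ ^ z.length := by
  have := H.isProbabilityMeasure_uniform
  have := H.nonempty_fin
  obtain ⟨y₀, hy₀⟩ := exists_prefixWord_eq z
  have hset : {y : ℕ → Fin N | prefixWord y z.length = z}
      = Set.pi (Finset.range z.length : Finset ℕ) fun i => {y₀ i} := by
    ext y
    simp only [Set.mem_ofPred_eq, Set.mem_pi, Finset.coe_range, Set.mem_Iio,
      Set.mem_singleton_iff]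
    constructor
    · intro h i hi
      rw [← hy₀, length_prefixWord] at h
      have h2 := List.ofFn_injective h
      exact congrFun h2 ⟨i, hi⟩
    · intro h
      exact (prefixWord_congr h).trans hy₀
  rw [hset, codeMeasure, Measure.infinitePi_pi _ fun _ _ => measurableSet_singleton _]
  simp

/-- The image of the uniform measure under the coding map. -/
noncomputable def measure : Measure (Euc d) := H.codeMeasure.map H.point

theorem measure_apply {s : Set (Euc d)} (hs : MeasurableSet s) :
    H.measure s = H.codeMeasure (H.point ⁻¹' s) :=
  Measure.map_apply H.continuous_point.measurable hs

theorem le_measure_ball (y : ℕ → Fin N) {n : ℕ} {ϱ : ℝ}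
    (h : H.size * H.rootRatio * ρ ^ n ≤ ϱ) :
    (N : ℝ≥0∞)⁻¹ ^ n ≤ H.measure (Metric.ball (H.point y) ϱ) := by
  rw [H.measure_apply Metric.isOpen_ball.measurableSet]
  have h1 := H.codeMeasure_prefix (prefixWord y n)
  rw [length_prefixWord] at h1
  rw [← h1]
  refine measure_mono fun y' hy' => ?_
  have hy'' : prefixWord y' n = prefixWord y n := hy'
  have h2 := H.point_mem y' n
  rw [hy''] at h2
  have h3 := H.dist_lt_of_mem_cell h2 (H.point_mem y n)
  rw [length_prefixWord] at h3
  exact h3.trans_le h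

theorem support_measure : H.measure.support = H.carrier := by
  have := H.isProbabilityMeasure_codeMeasure
  refine Set.Subset.antisymm ?_ ?_
  · refine Measure.support_subset_of_isClosed H.isCompact_carrier.isClosed ?_
    rw [mem_ae_iff, H.measure_apply H.isCompact_carrier.isClosed.measurableSet.compl]
    have : H.point ⁻¹' H.carrierᶜ = ∅ := by
      ext y
      simp [carrier]
    rw [this, measure_empty]
  · rintro _ ⟨y, rfl⟩
    rw [Metric.nhds_basis_ball.mem_measureSupport]
    intro η hη
    have hlim : Tendsto (fun n => H.size * H.rootRatio * ρ ^ n) atTop (𝓝 0) := by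
      simpa using (tendsto_pow_atTop_nhds_zero_of_lt_one H.pos_ratio.le H.ratio_lt_one).const_mul
        (H.size * H.rootRatio)
    obtain ⟨n, hn⟩ := (hlim.eventually_lt_const hη).exists
    refine lt_of_lt_of_le ?_ (H.le_measure_ball y hn.le)
    exact ENNReal.pow_pos (ENNReal.inv_pos.2 (ENNReal.natCast_ne_top N)) n

/-- At most `C` cells of depth `n` meet the ball, and each code of depth `n` has mass `N ^ (-n)`. -/
theorem measure_ball_le (C : ℝ) (hC : ∀ (F : Finset (List Λ)) (n : ℕ) (s : ℝ) (x : Euc d), 0 < s →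
      (∀ v ∈ F, v.length = n ∧ wordRatio Φ.ratio v = s ∧
        (Φ.cylinder v ∩ Metric.ball x s).Nonempty) → (F.card : ℝ) ≤ C) (x : Euc d) {n : ℕ} {ϱ : ℝ}
    (hϱ : ϱ ≤ H.rootRatio * ρ ^ n) :
    H.measure (Metric.ball x ϱ) ≤ ENNReal.ofReal C * (N : ℝ≥0∞)⁻¹ ^ n := by
  classical
  rw [H.measure_apply Metric.isOpen_ball.measurableSet]
  set Z : Finset (List (Fin N)) :=
    {z ∈ words (Fin N) n | (H.cell z ∩ Metric.ball x (H.rootRatio * ρ ^ n)).Nonempty} with hZ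
  have hlen : ∀ z ∈ Z, z.length = n := fun z hz => mem_words.1 (Finset.mem_filter.1 hz).1
  have hsub : H.point ⁻¹' Metric.ball x ϱ ⊆ ⋃ z ∈ Z, {y | prefixWord y z.length = z} := by
    intro y hy
    refine Set.mem_iUnion₂.2 ⟨prefixWord y n, ?_, by simp⟩
    rw [hZ, Finset.mem_filter, mem_words]
    exact ⟨length_prefixWord y n, H.point y, H.point_mem y n, Metric.ball_subset_ball hϱ hy⟩
  have hcard : (Z.card : ℝ) ≤ C := by
    have hinj : Set.InjOn H.node (Z : Set (List (Fin N))) := fun z hz z' hz' h =>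
      H.node_injOn ((hlen z hz).trans (hlen z' hz').symm) h
    rw [← Finset.card_image_of_injOn hinj]
    refine hC _ ((H.node []).length + m * n) (H.rootRatio * ρ ^ n) x
      (mul_pos H.rootRatio_pos (pow_pos H.pos_ratio n)) fun v hv => ?_
    obtain ⟨z, hz, rfl⟩ := Finset.mem_image.1 hv
    refine ⟨?_, ?_, (Finset.mem_filter.1 hz).2⟩
    · rw [H.length_node, hlen z hz]
    · rw [H.ratio_node, hlen z hz]
  calc _ ≤ H.codeMeasure (⋃ z ∈ Z, {y | prefixWord y z.length = z}) := measure_mono hsub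
    _ ≤ ∑ z ∈ Z, H.codeMeasure {y | prefixWord y z.length = z} := measure_biUnion_finset_le _ _
    _ = Z.card * (N : ℝ≥0∞)⁻¹ ^ n := by
        rw [Finset.sum_congr rfl fun z hz => by rw [H.codeMeasure_prefix, hlen z hz],
          Finset.sum_const, nsmul_eq_mul]
    _ ≤ _ := by
        gcongr
        rw [← ENNReal.ofReal_natCast]
        exact ENNReal.ofReal_le_ofReal hcard

theorem ahlforsRegularMeasure (hosc : Φ.OpenSetCondition) {δ : ℝ} (hδ : 0 < δ)
    (hN : N * ρ ^ δ = 1) : AhlforsRegularMeasure δ H.measure := by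
  have := H.isProbabilityMeasure_codeMeasure
  obtain ⟨C, hC1, hC⟩ := hosc.exists_card_le
  set r₀ := H.rootRatio with hr₀
  have hr₀0 : 0 < r₀ := H.rootRatio_pos
  have hρ0 := H.pos_ratio
  set c := H.size * r₀ with hc
  have hc0 : 0 < c := mul_pos H.size_pos hr₀0
  have hρδ : 0 < ρ ^ δ := Real.rpow_pos_of_pos hρ0 δ
  have hcδ : 0 < c ^ δ := Real.rpow_pos_of_pos hc0 δ
  have hrδ : 0 < r₀ ^ δ := Real.rpow_pos_of_pos hr₀0 δ
  have hinv : ∀ n : ℕ, (N : ℝ≥0∞)⁻¹ ^ n = ENNReal.ofReal ((ρ ^ n) ^ δ) := by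
    intro n
    have hN0 : (0 : ℝ) < N := by
      have := H.two_le
      exact_mod_cast (by omega : 0 < N)
    have h1 : ρ ^ δ = (N : ℝ)⁻¹ := eq_inv_of_mul_eq_one_right hN
    rw [← Real.rpow_pow_comm hρ0.le, h1, ENNReal.ofReal_pow (by positivity),
      ENNReal.ofReal_inv_of_pos hN0, ENNReal.ofReal_natCast]
  -- Rounding the radius to a cell scale costs one factor `ρ ^ δ` on either side. The `min` with 1
  -- below, and `C ≥ 1` above, take care of radii larger than the root scale, where total mass 1 is
  -- the comparison.
  refine ⟨min 1 (ρ ^ δ / c ^ δ), C / (ρ ^ δ * r₀ ^ δ), lt_min one_pos (by positivity),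
    by positivity, fun ϱ hϱ0 hϱ1 x hx => ⟨?_, ?_⟩⟩
  · rw [H.support_measure] at hx
    obtain ⟨y, rfl⟩ := hx
    have hϱδ : 0 < ϱ ^ δ := Real.rpow_pos_of_pos hϱ0 δ
    rcases le_or_gt ϱ c with hϱc | hϱc
    · obtain ⟨n, hn1, hn2⟩ := H.exists_scale hϱ0 hϱc
      refine le_trans ?_ (H.le_measure_ball y hn1.le)
      rw [hinv]
      refine ENNReal.ofReal_le_ofReal ?_
      calc _ ≤ ρ ^ δ / c ^ δ * (c * ρ ^ n) ^ δ := by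
            gcongr
            exact min_le_right _ _
        _ = (ρ ^ (n + 1)) ^ δ := by
            rw [Real.mul_rpow hc0.le (by positivity), pow_succ,
              Real.mul_rpow (by positivity) hρ0.le]
            field_simp
    · have h1 := H.le_measure_ball y (n := 0) (ϱ := ϱ) (by simpa using hϱc.le)
      rw [pow_zero] at h1
      refine le_trans ?_ h1
      rw [ENNReal.ofReal_le_one]
      have := Real.rpow_le_one hϱ0.le hϱ1.le hδ.le
      have := min_le_left 1 (ρ ^ δ / c ^ δ)
      nlinarith
  · rcases le_or_gt ϱ r₀ with hϱc | hϱc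
    · obtain ⟨n, hn1, hn2⟩ := H.exists_scale hϱ0 hϱc
      refine (H.measure_ball_le C hC x hn2).trans ?_
      rw [hinv, ← ENNReal.ofReal_mul (by linarith)]
      refine ENNReal.ofReal_le_ofReal ?_
      calc C * (ρ ^ n) ^ δ = C / (ρ ^ δ * r₀ ^ δ) * (r₀ * ρ ^ (n + 1)) ^ δ := by
            rw [Real.mul_rpow hr₀0.le (by positivity), pow_succ,
              Real.mul_rpow (by positivity) hρ0.le]
            field_simp
        _ ≤ _ := by gcongr
    · refine le_trans (b := 1) ?_ ?_
      · rw [H.measure_apply Metric.isOpen_ball.measurableSet]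
        exact prob_le_one
      · rw [ENNReal.one_le_ofReal]
        have h1 : r₀ ^ δ ≤ ϱ ^ δ := Real.rpow_le_rpow hr₀0.le hϱc.le hδ.le
        have h2 : ρ ^ δ ≤ 1 := Real.rpow_le_one hρ0.le H.ratio_lt_one.le hδ.le
        rw [div_mul_eq_mul_div, one_le_div (by positivity)]
        calc ρ ^ δ * r₀ ^ δ ≤ 1 * ϱ ^ δ := by gcongr
          _ ≤ C * ϱ ^ δ := by gcongr

theorem ahlforsRegular_and_le_dimH (hosc : Φ.OpenSetCondition) {t t' : ℝ}
    (ht : 0 < t) (hN : ρ ^ (-t) ≤ N) (hN' : N ≤ ρ ^ (-t')) :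
    AhlforsRegular H.carrier ∧ ENNReal.ofReal t ≤ dimH H.carrier ∧
      dimH H.carrier ≤ ENNReal.ofReal t' := by
  have hρ0 := H.pos_ratio
  have hN0 : (0 : ℝ) < N := by
    have := H.two_le
    exact_mod_cast (by omega : 0 < N)
  have hlogρ : Real.log ρ < 0 := Real.log_neg hρ0 H.ratio_lt_one
  -- The similarity dimension, the solution of `N ρ ^ δ = 1`.
  set δ := Real.log N / -Real.log ρ with hδ
  have htδ : t ≤ δ := by
    rw [hδ, le_div_iff₀ (by linarith)]
    have := Real.log_le_log (Real.rpow_pos_of_pos hρ0 _) hN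
    rw [Real.log_rpow hρ0] at this
    linarith
  have hδt' : δ ≤ t' := by
    rw [hδ, div_le_iff₀ (by linarith)]
    have := Real.log_le_log hN0 hN'
    rw [Real.log_rpow hρ0] at this
    linarith
  have hδ0 : 0 < δ := ht.trans_le htδ
  have hNδ : N * ρ ^ δ = 1 := by
    have : ρ ^ δ = (N : ℝ)⁻¹ := by
      rw [Real.rpow_def_of_pos hρ0, hδ, ← Real.exp_log hN0, ← Real.exp_neg, Real.log_exp]
      congr 1
      have := hlogρ.ne
      field_simp
    rw [this, mul_inv_cancel₀ hN0.ne']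
  have hreg := H.ahlforsRegularMeasure hosc hδ0 hNδ
  refine ⟨⟨δ, hδ0, H.measure, hreg, H.support_measure⟩, ?_, ?_⟩
  · refine (ENNReal.ofReal_le_ofReal htδ).trans ?_
    rw [← H.support_measure]
    refine hreg.le_dimH hδ0 fun h0 => ?_
    have h1 := H.support_measure
    rw [h0, Measure.support_zero] at h1
    exact H.carrier_nonempty.ne_empty h1.symm
  · exact (H.dimH_carrier_le hδ0.le hNδ.le).trans (ENNReal.ofReal_le_ofReal hδt')

end HomogeneousTree

/-! ### Homogeneous trees inside the Galton–Watson tree -/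

section CoreTree

variable {d : ℕ} {Λ : Type*} [Finite Λ] [Nonempty Λ] {Φ : SimilarityIFS d Λ}

/-- The children are the words `v ++ b` with `v` in the selection and `b ∈ B`, distinct because all
`v` have length `k`. A single `v` already carries a full copy of `B`, scaled by `R`, and this
suffices for the spread. -/
theorem exists_children {V B : Finset (List Λ)} {M k n : ℕ} {R ρ ε : ℝ}
    (hV : ∀ v ∈ V, v.length = k ∧ wordRatio Φ.ratio v = R)
    (hB : ∀ b ∈ B, b.length = n ∧ wordRatio Φ.ratio b = ρ) (hspread : Φ.Spread ε B)
    (hM : 0 < M) {w : List Λ → Set Λ} (hw : w ∈ ⋂ m, coreSet V B M m) :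
    ∃ χ : Fin (M * B.card) → List Λ, Function.Injective χ ∧ (∀ j, (χ j).length = k + n) ∧
      (∀ j, wordRatio Φ.ratio (χ j) = R * ρ) ∧ (∀ j, InTree w (χ j)) ∧
      (∀ j, shift (χ j) w ∈ ⋂ m, coreSet V B M m) ∧ Φ.Spread (R * ε) (Set.range χ) := by
  classical
  obtain ⟨S, hSV, hSc, hS⟩ := exists_subset_of_mem_iInter_coreSet hw
  set F : Finset (List Λ) := (S ×ˢ B).image fun p => p.1 ++ p.2 with hF
  have hFc : F.card = M * B.card := by
    rw [hF, Finset.card_image_of_injOn, Finset.card_product, hSc]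
    rintro ⟨v, b⟩ hp ⟨v', b'⟩ hp' h
    rw [Finset.mem_coe, Finset.mem_product] at hp hp'
    obtain ⟨h1, h2⟩ := List.append_inj h
      ((hV v (hSV hp.1)).1.trans (hV v' (hSV hp'.1)).1.symm)
    exact Prod.ext h1 h2
  have hmem : ∀ c ∈ F, c.length = k + n ∧ wordRatio Φ.ratio c = R * ρ ∧ InTree w c ∧
      shift c w ∈ ⋂ m, coreSet V B M m := by
    intro c hc
    obtain ⟨⟨v, b⟩, hp, rfl⟩ := Finset.mem_image.1 hc
    rw [Finset.mem_product] at hp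
    obtain ⟨h1, h2⟩ := hS v hp.1
    obtain ⟨h3, h4⟩ := h2 b hp.2
    refine ⟨?_, ?_, (inTree_append w v b).2 ⟨h1, h3⟩, h4⟩
    · rw [List.length_append, (hV v (hSV hp.1)).1, (hB b hp.2).1]
    · rw [wordRatio_append, (hV v (hSV hp.1)).2, (hB b hp.2).2]
  set e := (F.equivFinOfCardEq hFc).symm with he
  have hcm : ∀ j, ((e j : F) : List Λ) ∈ F := fun j => (e j).2
  refine ⟨fun j => e j, Subtype.val_injective.comp e.injective, fun j => (hmem _ (hcm j)).1,
    fun j => (hmem _ (hcm j)).2.1, fun j => (hmem _ (hcm j)).2.2.1,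
    fun j => (hmem _ (hcm j)).2.2.2, ?_⟩
  obtain ⟨v, hv⟩ : S.Nonempty := Finset.card_pos.1 (by omega)
  rw [← (hV v (hSV hv)).2]
  refine (hspread.append v).of_prefix ?_
  rintro _ ⟨b, hb, rfl⟩
  have hc : v ++ b ∈ F := Finset.mem_image.2 ⟨(v, b), Finset.mem_product.2 ⟨hv, hb⟩, rfl⟩
  exact ⟨v ++ b, ⟨e.symm ⟨v ++ b, hc⟩, by simp⟩, List.prefix_rfl⟩

/-- The word reached from the root by following the choices `z`, where `χ w` enumerates the
children of the root in the environment `w`. -/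
def address {N : ℕ} (χ : (List Λ → Set Λ) → Fin N → List Λ) :
    List (Fin N) → (List Λ → Set Λ) → List Λ
  | [], _ => []
  | j :: z, w => χ w j ++ address χ z (shift (χ w j) w)

theorem address_append_singleton {N : ℕ} (χ : (List Λ → Set Λ) → Fin N → List Λ)
    (z : List (Fin N)) (j : Fin N) (w : List Λ → Set Λ) :
    address χ (z ++ [j]) w = address χ z w ++ χ (shift (address χ z w) w) j := by
  induction z generalizing w with
  | nil => simp [address]
  | cons i z ih =>
    rw [List.cons_append, address, ih, address, shift_shift, List.append_assoc]

theorem address_mem {N : ℕ} {χ : (List Λ → Set Λ) → Fin N → List Λ}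
    {A : Set (List Λ → Set Λ)} (h : ∀ w ∈ A, ∀ j, InTree w (χ w j) ∧ shift (χ w j) w ∈ A)
    (z : List (Fin N)) {w : List Λ → Set Λ} (hw : w ∈ A) :
    InTree w (address χ z w) ∧ shift (address χ z w) w ∈ A := by
  induction z generalizing w with
  | nil => simpa [address] using hw
  | cons j z ih =>
    obtain ⟨h1, h2⟩ := h w hw j
    obtain ⟨h3, h4⟩ := ih h2
    rw [address, inTree_append, ← shift_shift]
    exact ⟨⟨h1, h3⟩, h4⟩

/-- The children are chosen as a function of the environment alone. Below each child the shifted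
environment is again in the core event, so the same choice function generates the whole tree. -/
theorem exists_homogeneousTree {V B : Finset (List Λ)} {M k n : ℕ} {R ρ ε : ℝ}
    (hV : ∀ v ∈ V, v.length = k ∧ wordRatio Φ.ratio v = R)
    (hB : ∀ b ∈ B, b.length = n ∧ wordRatio Φ.ratio b = ρ) (hspread : Φ.Spread ε B)
    (hBne : B.Nonempty) (hM : 2 ≤ M) (hk : 0 < k) (hR0 : 0 < R) (hR1 : R < 1) (hρ0 : 0 < ρ)
    (hρ1 : ρ ≤ 1) (hε : 0 < ε) {w : List Λ → Set Λ} {v : List Λ} (hv : InTree w v)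
    (hw : shift v w ∈ ⋂ m, coreSet V B M m) :
    ∃ H : HomogeneousTree Φ (M * B.card) (k + n) (R * ρ) (R * ε), ∀ z, InTree w (H.node z) := by
  have hex : ∀ w : List Λ → Set Λ, w ∈ ⋂ m, coreSet V B M m → _ := fun w hw =>
    exists_children hV hB hspread (by omega) hw
  choose! χ hinj hlen hratio htree hshift hspr using hex
  have haddr : ∀ z, _ := fun z =>
    address_mem (χ := χ) (fun w hw j => ⟨htree w hw j, hshift w hw j⟩) z hw
  refine ⟨{
    node := fun z => v ++ address χ z (shift v w)
    child := fun z j => χ (shift (address χ z (shift v w)) (shift v w)) j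
    node_append := fun z j => by rw [address_append_singleton, List.append_assoc]
    child_injective := fun z => hinj _ (haddr z).2
    length_child := fun z j => hlen _ (haddr z).2 j
    ratio_child := fun z j => hratio _ (haddr z).2 j
    spread_child := fun z => hspr _ (haddr z).2
    two_le := hM.trans (Nat.le_mul_of_pos_right M (Finset.card_pos.2 hBne))
    pos_length := by omega
    pos_ratio := mul_pos hR0 hρ0
    ratio_lt_one := by nlinarith
    pos_spread := mul_pos hR0 hε }, fun z => ?_⟩
  exact (inTree_append w v _).2 ⟨hv, (haddr z).1⟩

end CoreTree

/-! ### Non-planarity -/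

section NonPlanar

variable {d : ℕ}

/-- Turns hyperplanes into points of the compact unit sphere, where limits can be taken. -/
theorem IsHyperplane.exists_unit_normal {L : AffineSubspace ℝ (Euc d)} (hL : IsHyperplane L) :
    ∃ (u : Euc d) (c : ℝ), ‖u‖ = 1 ∧ ∀ (ε : ℝ) (x : Euc d),
      x ∈ Metric.thickening ε (L : Set (Euc d)) → |inner ℝ u x - c| ≤ ε := by
  obtain ⟨⟨p, hp⟩, hdim⟩ := hL
  have hne : L.directionᗮ ≠ ⊥ := by
    intro h
    have h1 := Submodule.finrank_add_finrank_orthogonal L.direction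
    rw [h, finrank_bot, finrank_euclideanSpace_fin] at h1
    omega
  obtain ⟨u, hu, hu0⟩ := Submodule.exists_mem_ne_zero_of_ne_bot hne
  refine ⟨‖u‖⁻¹ • u, inner ℝ (‖u‖⁻¹ • u) p, ?_, fun ε x hx => ?_⟩
  · rw [norm_smul, norm_inv, norm_norm, inv_mul_cancel₀ (norm_ne_zero_iff.2 hu0)]
  · obtain ⟨z, hz, hxz⟩ := Metric.mem_thickening_iff.1 hx
    have hzp : inner ℝ u (z - p) = 0 := by
      rw [real_inner_comm]
      exact (Submodule.mem_orthogonal _ _).1 hu _ (AffineSubspace.vsub_mem_direction hz hp)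
    have h1 : inner ℝ (‖u‖⁻¹ • u) x - inner ℝ (‖u‖⁻¹ • u) p = inner ℝ (‖u‖⁻¹ • u) (x - z) := by
      have h2 : x - z = (x - p) - (z - p) := by abel
      rw [h2, inner_sub_right, inner_smul_left _ (z - p), hzp, mul_zero, sub_zero, inner_sub_right]
    rw [h1]
    refine (abs_real_inner_le_norm _ _).trans ?_
    rw [norm_smul, norm_inv, norm_norm, inv_mul_cancel₀ (norm_ne_zero_iff.2 hu0), one_mul,
      ← dist_eq_norm]
    exact hxz.le

theorem exists_hyperplane_of_normal {u : Euc d} (hu : u ≠ 0) (p : Euc d) :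
    ∃ L : AffineSubspace ℝ (Euc d), IsHyperplane L ∧
      ∀ x, inner ℝ u (x - p) = 0 → x ∈ (L : Set (Euc d)) := by
  refine ⟨AffineSubspace.mk' p (ℝ ∙ u)ᗮ, ⟨⟨p, AffineSubspace.self_mem_mk' _ _⟩, ?_⟩,
    fun x hx => ?_⟩
  · rw [AffineSubspace.direction_mk']
    have h1 := Submodule.finrank_add_finrank_orthogonal (ℝ ∙ u)
    rw [finrank_span_singleton hu, finrank_euclideanSpace_fin] at h1
    omega
  · rw [SetLike.mem_coe, AffineSubspace.mem_mk', Submodule.mem_orthogonal_singleton_iff_inner_right]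
    exact hx

variable {Λ : Type*} [Finite Λ] [Nonempty Λ] (Φ : SimilarityIFS d Λ)

theorem exists_ratio_bound : ∃ c : ℝ, 0 < c ∧ c < 1 ∧ ∀ i, Φ.ratio i ≤ c := by
  obtain ⟨i, hi⟩ := Finite.exists_max Φ.ratio
  exact ⟨Φ.ratio i, Φ.ratio_pos i, Φ.ratio_lt_one i, hi⟩

theorem exists_mem_cylinder_of_mem_limitSet {w : List Λ → Set Λ} {x : Euc d}
    (hx : x ∈ limitSet Φ w) (n : ℕ) : ∃ v : List Λ, v.length = n ∧ InTree w v ∧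
      x ∈ Φ.cylinder v := by
  obtain ⟨y, hy, hxy⟩ := Set.mem_iUnion₂.1 hx
  have h := (mem_treeLevel_iff w n _).1 (hy n)
  exact ⟨prefixWord y n, h.1, h.2, Set.mem_iInter.1 hxy n⟩

/-- Otherwise, for each `n` some hyperplane comes within `1 / (n + 1)` of every level-`n` cylinder
of the tree, hence close to the whole limit set. A limit of unit normals is orthogonal to all
differences of points of the limit set, which is therefore planar. Working with differences makes
convergence of the offsets unnecessary. -/
theorem exists_spread_level {w : List Λ → Set Λ}
    (hw : ∀ L : AffineSubspace ℝ (Euc d), IsHyperplane L →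
      ¬ limitSet Φ w ⊆ (L : Set (Euc d))) :
    ∃ (n : ℕ) (ε : ℝ), 0 < ε ∧ Φ.Spread ε {v | v.length = n ∧ InTree w v} := by
  by_contra! hcon
  obtain ⟨c, hc0, hc1, hrc⟩ := exists_ratio_bound Φ
  have hstep : ∀ n : ℕ, ∃ (u : Euc d) (a : ℝ), ‖u‖ = 1 ∧ ∀ x ∈ limitSet Φ w,
      |inner ℝ u x - a| ≤ 1 / ((n : ℝ) + 1) + c ^ n * Metric.diam Φ.attractor := by
    intro n
    have h := hcon n (1 / ((n : ℝ) + 1)) (by positivity)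
    unfold Spread at h
    push Not at h
    obtain ⟨L, hL, hmeet⟩ := h
    obtain ⟨u, a, hu, hua⟩ := hL.exists_unit_normal
    refine ⟨u, a, hu, fun x hx => ?_⟩
    obtain ⟨v, hvl, hvT, hxv⟩ := exists_mem_cylinder_of_mem_limitSet Φ hx n
    obtain ⟨y, hyv, hyL⟩ := Set.not_disjoint_iff.1 (hmeet v ⟨hvl, hvT⟩)
    have h1 := hua _ y hyL
    have h2 : |inner ℝ u (x - y)| ≤ c ^ n * Metric.diam Φ.attractor := by
      refine (abs_real_inner_le_norm _ _).trans ?_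
      rw [hu, one_mul, ← dist_eq_norm]
      refine (Φ.dist_le_of_mem_cylinder hxv hyv).trans ?_
      rw [← hvl]
      exact mul_le_mul_of_nonneg_right (wordRatio_le_pow Φ.ratio_pos hrc v) Metric.diam_nonneg
    have h3 : inner ℝ u x - a = (inner ℝ u y - a) + inner ℝ u (x - y) := by
      rw [inner_sub_right]
      ring
    rw [h3]
    exact (abs_add_le _ _).trans (add_le_add h1 h2)
  choose u a hu hua using hstep
  obtain ⟨v, hv, φ, hφ, hlim⟩ := (isCompact_sphere (0 : Euc d) 1).tendsto_subseq
    (x := u) fun n => by simp [hu]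
  have hv0 : v ≠ 0 := by
    rintro rfl
    simp at hv
  have hη : Tendsto (fun n : ℕ => 1 / ((n : ℝ) + 1) + c ^ n * Metric.diam Φ.attractor) atTop
      (𝓝 0) := by
    have h1 := tendsto_one_div_add_atTop_nhds_zero_nat (𝕜 := ℝ)
    have h2 := (tendsto_pow_atTop_nhds_zero_of_lt_one hc0.le hc1).mul_const
      (Metric.diam Φ.attractor)
    simpa using h1.add h2
  have horth : ∀ x ∈ limitSet Φ w, ∀ y ∈ limitSet Φ w, inner ℝ v (x - y) = 0 := by
    intro x hx y hy
    have h1 : Tendsto (fun n => |inner ℝ (u (φ n)) (x - y)|) atTop (𝓝 |inner ℝ v (x - y)|) :=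
      ((hlim.inner tendsto_const_nhds)).abs
    have h2 := ((hη.add hη).comp hφ.tendsto_atTop)
    have h3 := le_of_tendsto_of_tendsto' h1 h2 fun n => by
      have h4 := hua (φ n) x hx
      have h5 := hua (φ n) y hy
      have h6 : inner ℝ (u (φ n)) (x - y)
          = (inner ℝ (u (φ n)) x - a (φ n)) - (inner ℝ (u (φ n)) y - a (φ n)) := by
        rw [inner_sub_right]
        ring
      rw [h6]
      exact (abs_sub _ _).trans (add_le_add h4 h5)
    rw [add_zero] at h3
    exact abs_eq_zero.1 (le_antisymm h3 (abs_nonneg _))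
  rcases (limitSet Φ w).eq_empty_or_nonempty with hemp | ⟨p, hp⟩
  · obtain ⟨L, hL, -⟩ := exists_hyperplane_of_normal hv0 0
    exact hw L hL (by simp [hemp])
  · obtain ⟨L, hL, hLx⟩ := exists_hyperplane_of_normal hv0 p
    exact hw L hL fun x hx => hLx x (horth x hx p hp)

variable (ν : Measure (Set Λ)) [IsProbabilityMeasure ν]

/-- There are only countably many finite sets of words. If every spread one had probability zero,
almost surely none would lie in the tree, against `exists_spread_level`. -/
theorem exists_spread_finset
    (hplanar : ¬ ∀ᵐ w ∂envLaw ν, ∃ L : AffineSubspace ℝ (Euc d), IsHyperplane L ∧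
      limitSet Φ w ⊆ (L : Set (Euc d))) :
    ∃ (B : Finset (List Λ)) (n : ℕ) (ε : ℝ), 0 < ε ∧ (∀ b ∈ B, b.length = n) ∧
      Φ.Spread ε (B : Set (List Λ)) ∧ 0 < (envLaw ν).real {w | ∀ b ∈ B, InTree w b} := by
  classical
  cases nonempty_fintype Λ
  by_contra hcon
  push Not at hcon
  refine hplanar ?_
  have hae : ∀ᵐ w ∂envLaw ν, ∀ B : Finset (List Λ),
      (envLaw ν).real {w | ∀ b ∈ B, InTree w b} ≤ 0 → ¬ ∀ b ∈ B, InTree w b := by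
    rw [ae_all_iff]
    intro B
    by_cases h : (envLaw ν).real {w | ∀ b ∈ B, InTree w b} ≤ 0
    · have h0 : envLaw ν {w | ∀ b ∈ B, InTree w b} = 0 :=
        (measureReal_eq_zero_iff).1 (le_antisymm h measureReal_nonneg)
      filter_upwards [measure_eq_zero_iff_ae_notMem.1 h0] with w hw _ using hw
    · exact Eventually.of_forall fun w h' => absurd h' h
  filter_upwards [hae] with w hw
  by_contra hL
  push Not at hL
  obtain ⟨n, ε, hε, hspread⟩ := exists_spread_level Φ hL
  set B : Finset (List Λ) := (words Λ n).filter fun v => InTree w v with hB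
  have hset : (B : Set (List Λ)) = {v | v.length = n ∧ InTree w v} := by
    ext v
    simp [hB]
  rw [← hset] at hspread
  refine hw B (hcon B n ε hε (fun b hb => mem_words.1 (Finset.mem_filter.1 hb).1) hspread)
    fun b hb => (Finset.mem_filter.1 hb).2

theorem wordRatio_flatten (r : Λ → ℝ) (l : List (List Λ)) :
    wordRatio r l.flatten = (l.map (wordRatio r)).prod := by
  induction l with
  | nil => simp
  | cons a l ih => rw [List.flatten_cons, wordRatio_append, ih, List.map_cons, List.prod_cons]

/-- Each word of `B` is followed by the concatenation of all the others, so every ratio becomes the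
product over `B`. Lengthening words preserves spread. The tails sit in independent subtrees, and
each has positive probability because every letter does. -/
theorem exists_homogeneous_spread_finset (hd : 0 < d) (hp : ∀ i, 0 < letterProb ν i)
    (hplanar : ¬ ∀ᵐ w ∂envLaw ν, ∃ L : AffineSubspace ℝ (Euc d), IsHyperplane L ∧
      limitSet Φ w ⊆ (L : Set (Euc d))) :
    ∃ (B : Finset (List Λ)) (n : ℕ) (ρ ε : ℝ), 0 < ρ ∧ ρ ≤ 1 ∧ 0 < ε ∧ B.Nonempty ∧
      (∀ b ∈ B, b.length = n ∧ wordRatio Φ.ratio b = ρ) ∧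
      Φ.Spread ε (B : Set (List Λ)) ∧ 0 < (envLaw ν).real {w | ∀ b ∈ B, InTree w b} := by
  classical
  obtain ⟨B, n, ε, hε, hlen, hspread, hpos⟩ := exists_spread_finset Φ ν hplanar
  set tail : List Λ → List Λ := fun a => (B.erase a).toList.flatten with htail
  set ρ := ∏ b ∈ B, wordRatio Φ.ratio b with hρ
  have hratio : ∀ a ∈ B, wordRatio Φ.ratio (a ++ tail a) = ρ := by
    intro a ha
    rw [wordRatio_append, wordRatio_flatten, Finset.prod_map_toList, Finset.mul_prod_erase B _ ha]
  have hltail : ∀ a ∈ B, (tail a).length = (B.card - 1) * n := by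
    intro a ha
    rw [htail, List.length_flatten, Finset.sum_map_toList,
      Finset.sum_congr rfl fun b hb => hlen b (Finset.mem_of_mem_erase hb), Finset.sum_const,
      Finset.card_erase_of_mem ha, smul_eq_mul]
  refine ⟨B.image fun a => a ++ tail a, n + (B.card - 1) * n, ρ, ε,
    Finset.prod_pos fun b _ => Φ.wordRatio_ratio_pos b,
    Finset.prod_le_one (fun b _ => (Φ.wordRatio_ratio_pos b).le) fun b _ => ?_, hε, ?_, ?_, ?_, ?_⟩
  · simpa using wordRatio_le_pow Φ.ratio_pos (fun i => (Φ.ratio_lt_one i).le) b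
  -- Spread gives a word only once a hyperplane exists, and this is where `d > 0` enters.
  · obtain ⟨u, hu⟩ : ∃ u : Euc d, u ≠ 0 := by
      have : Nontrivial (Euc d) := by
        rw [← Module.finrank_pos_iff (R := ℝ), finrank_euclideanSpace_fin]
        exact hd
      exact exists_ne 0
    obtain ⟨L, hL, -⟩ := exists_hyperplane_of_normal hu 0
    obtain ⟨b, hb, -⟩ := hspread L hL
    exact ⟨_, Finset.mem_image_of_mem _ hb⟩
  · intro b hb
    obtain ⟨a, ha, rfl⟩ := Finset.mem_image.1 hb
    refine ⟨?_, hratio a ha⟩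
    rw [List.length_append, hlen a ha, hltail a ha]
  · refine hspread.of_prefix fun a ha => ⟨a ++ tail a, ?_, List.prefix_append _ _⟩
    exact Finset.mem_coe.2 (Finset.mem_image.2 ⟨a, ha, rfl⟩)
  · have hC : MeasurableSet[sigmaOn {a | a.length < n}]
        {w : List Λ → Set Λ | ∀ b ∈ B, InTree w b} := by
      have : {w : List Λ → Set Λ | ∀ b ∈ B, InTree w b} = ⋂ b ∈ B, {w | InTree w b} := by
        ext w
        simp
      rw [this]
      exact Finset.measurableSet_biInter _ fun b hb => measurableSet_inTree_sigmaOn (hlen b hb).le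
    have h := envLaw_real_inter_shift ν n B hlen hC (A := fun a => {w | InTree w (tail a)})
      fun _ _ => measurableSet_inTree _
    have hpos' : 0 < (envLaw ν).real {w | ∀ b ∈ B, InTree w b}
        * ∏ a ∈ B, (envLaw ν).real {w | InTree w (tail a)} :=
      mul_pos hpos (Finset.prod_pos fun a _ => wordProb_pos ν hp (tail a))
    rw [← h] at hpos'
    refine hpos'.trans_le (measureReal_mono fun w hw b hb => ?_)
    obtain ⟨a, ha, rfl⟩ := Finset.mem_image.1 hb
    exact (inTree_append w a _).2 ⟨hw.1 a ha, hw.2 a ha⟩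

end NonPlanar

/-! ### The dimension of the random fractal -/

section Dimension

variable {d : ℕ} {Λ : Type*} [Fintype Λ] [DecidableEq Λ] [Nonempty Λ] (Φ : SimilarityIFS d Λ)
  (ν : Measure (Set Λ)) [IsProbabilityMeasure ν]

/-- For `s > δ` the expected `s`-sum over level `k` is `θ ^ k` with `θ < 1`. These are summable, so
almost surely the sums tend to 0, and level-`k` cylinders of the tree cover the limit set. -/
theorem ae_dimH_limitSet_le_of_lt {δ s : ℝ} (hp : ∀ i, 0 < letterProb ν i) (hδ0 : 0 < δ)
    (hδ : ∑ i, letterProb ν i * Φ.ratio i ^ δ = 1) (hs : δ < s) :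
    ∀ᵐ w ∂envLaw ν, dimH (limitSet Φ w) ≤ ENNReal.ofReal s := by
  classical
  have hs0 : 0 < s := hδ0.trans hs
  set θ := ∑ i, letterProb ν i * Φ.ratio i ^ s with hθ
  have hθ0 : 0 ≤ θ := Finset.sum_nonneg fun i _ =>
    mul_nonneg (letterProb_nonneg ν i) (Real.rpow_nonneg (Φ.ratio_pos i).le s)
  have hθ1 : θ < 1 := by
    rw [← hδ, hθ]
    refine Finset.sum_lt_sum_of_nonempty Finset.univ_nonempty fun i _ => ?_
    exact mul_lt_mul_of_pos_left
      (Real.rpow_lt_rpow_of_exponent_gt (Φ.ratio_pos i) (Φ.ratio_lt_one i) hs) (hp i)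
  set X : ℕ → (List Λ → Set Λ) → ℝ≥0∞ := fun k w => ∑ v ∈ words Λ k,
    {w : List Λ → Set Λ | InTree w v}.indicator
      (fun _ => ENNReal.ofReal (wordRatio Φ.ratio v ^ s)) w with hX
  have hXm : ∀ k, Measurable (X k) := fun k => Finset.measurable_fun_sum _ fun v _ =>
    measurable_const.indicator (measurableSet_inTree v)
  have hXint : ∀ k, ∫⁻ w, X k w ∂envLaw ν = ENNReal.ofReal (θ ^ k) := by
    intro k
    rw [lintegral_finsetSum _ fun v _ => measurable_const.indicator (measurableSet_inTree v),
      ← sum_wordProb_mul_rpow ν Φ.ratio_pos s k, ENNReal.ofReal_sum_of_nonneg]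
    · refine Finset.sum_congr rfl fun v _ => ?_
      rw [lintegral_indicator_const (measurableSet_inTree v),
        ENNReal.ofReal_mul (wordProb_nonneg ν v), wordProb, ofReal_measureReal, mul_comm]
    · exact fun v _ => mul_nonneg (wordProb_nonneg ν v)
        (Real.rpow_nonneg (Φ.wordRatio_ratio_pos v).le s)
  have hfin : ∫⁻ w, ∑' k, X k w ∂envLaw ν ≠ ⊤ := by
    rw [lintegral_tsum fun k => (hXm k).aemeasurable]
    simp only [hXint]
    rw [← ENNReal.ofReal_tsum_of_nonneg (fun k => pow_nonneg hθ0 k)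
      (summable_geometric_of_lt_one hθ0 hθ1)]
    exact ENNReal.ofReal_ne_top
  filter_upwards [ae_lt_top (Measurable.tsum hXm) hfin] with w hw
  have hX0 : Tendsto (fun k => X k w) atTop (𝓝 0) :=
    ENNReal.tendsto_atTop_zero_of_tsum_ne_top hw.ne
  set D := Metric.diam Φ.attractor with hD
  have hD0 : 0 ≤ D := Metric.diam_nonneg
  obtain ⟨c, hc0, hc1, hrc⟩ := exists_ratio_bound Φ
  have hlim : Tendsto (fun n : ℕ => ENNReal.ofReal (c ^ n * D)) atTop (𝓝 0) := by
    have h := (tendsto_pow_atTop_nhds_zero_of_lt_one hc0.le hc1).mul_const D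
    rw [zero_mul] at h
    simpa [Function.comp_def] using (ENNReal.continuous_ofReal.tendsto _).comp h
  have hle := Measure.hausdorffMeasure_le_liminf_sum s (limitSet Φ w) (l := atTop)
    (fun n : ℕ => ENNReal.ofReal (c ^ n * D)) hlim
    (fun n (v : words Λ n) => if InTree w v then Φ.cylinder v else ∅)
    (Eventually.of_forall fun n v => by
      split_ifs
      · refine (Φ.ediam_cylinder_le v).trans (ENNReal.ofReal_le_ofReal ?_)
        refine mul_le_mul_of_nonneg_right ?_ hD0
        have := wordRatio_le_pow Φ.ratio_pos hrc (v : List Λ)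
        rwa [mem_words.1 v.2] at this
      · simp)
    (Eventually.of_forall fun n x hx => by
      obtain ⟨v, hvl, hvT, hxv⟩ := exists_mem_cylinder_of_mem_limitSet Φ hx n
      refine Set.mem_iUnion.2 ⟨⟨v, mem_words.2 hvl⟩, ?_⟩
      rwa [if_pos hvT])
  have hbound : ∀ n, ∑ v : words Λ n,
      Metric.ediam (if InTree w v then Φ.cylinder v else ∅) ^ s
        ≤ ENNReal.ofReal (D ^ s) * X n w := by
    intro n
    rw [Finset.sum_coe_sort (words Λ n)
      (fun v => Metric.ediam (if InTree w v then Φ.cylinder v else ∅) ^ s), hX, Finset.mul_sum]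
    refine Finset.sum_le_sum fun v _ => ?_
    by_cases hv : InTree w v
    · have hr := Φ.wordRatio_ratio_pos v
      rw [if_pos hv, Set.indicator_of_mem (by exact hv),
        ← ENNReal.ofReal_mul (Real.rpow_nonneg hD0 s)]
      refine (ENNReal.rpow_le_rpow (Φ.ediam_cylinder_le v) hs0.le).trans (le_of_eq ?_)
      rw [ENNReal.ofReal_rpow_of_nonneg (mul_nonneg hr.le hD0) hs0.le, Real.mul_rpow hr.le hD0,
        mul_comm]
    · rw [if_neg hv, Metric.ediam_empty, ENNReal.zero_rpow_of_pos hs0]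
      exact zero_le
  have hzero : Measure.hausdorffMeasure s (limitSet Φ w) = 0 := by
    refine le_antisymm (hle.trans ?_) zero_le
    have h1 : Tendsto (fun n => ENNReal.ofReal (D ^ s) * X n w) atTop (𝓝 0) := by
      simpa using ENNReal.Tendsto.const_mul hX0 (Or.inr ENNReal.ofReal_ne_top)
    rw [← h1.liminf_eq]
    exact liminf_le_liminf (Eventually.of_forall hbound)
  have hne : Measure.hausdorffMeasure ((⟨s, hs0.le⟩ : ℝ≥0) : ℝ) (limitSet Φ w) ≠ ⊤ := by
    change Measure.hausdorffMeasure s (limitSet Φ w) ≠ ⊤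
    rw [hzero]
    exact ENNReal.zero_ne_top
  refine (dimH_le_of_hausdorffMeasure_ne_top hne).trans (le_of_eq ?_)
  rw [ENNReal.ofReal]
  congr 1
  exact (Real.toNNReal_of_nonneg hs0.le).symm

theorem ae_dimH_limitSet_le {δ : ℝ} (hp : ∀ i, 0 < letterProb ν i) (hδ0 : 0 < δ)
    (hδ : ∑ i, letterProb ν i * Φ.ratio i ^ δ = 1) :
    ∀ᵐ w ∂envLaw ν, dimH (limitSet Φ w) ≤ ENNReal.ofReal δ := by
  have hae : ∀ᵐ w ∂envLaw ν, ∀ n : ℕ,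
      dimH (limitSet Φ w) ≤ ENNReal.ofReal (δ + 1 / ((n : ℝ) + 1)) :=
    ae_all_iff.2 fun n => ae_dimH_limitSet_le_of_lt Φ ν hp hδ0 hδ
      (lt_add_of_pos_right δ (by positivity))
  filter_upwards [hae] with w hw
  have h := (tendsto_one_div_add_atTop_nhds_zero_nat (𝕜 := ℝ)).const_add δ
  rw [add_zero] at h
  exact ge_of_tendsto' ((ENNReal.continuous_ofReal.tendsto _).comp h) hw

/-- Almost surely on survival, the random fractal contains a diffuse set whose dimension is, under
the open set condition, in a given interval below the almost sure dimension. -/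
theorem ae_exists_diffuse_subset (hd : 0 < d) (hp : ∀ i, 0 < letterProb ν i)
    (hsuper : 1 < ∫ s : Set Λ, (s.ncard : ℝ) ∂ν) {δ : ℝ} (hδ0 : 0 < δ)
    (hδ : ∑ i, letterProb ν i * Φ.ratio i ^ δ = 1)
    (hplanar : ¬ ∀ᵐ w ∂envLaw ν, ∃ L : AffineSubspace ℝ (Euc d), IsHyperplane L ∧
      limitSet Φ w ⊆ (L : Set (Euc d)))
    {t t' : ℝ} (ht : 0 < t) (htt' : t < t') (ht' : t' < δ) :
    ∀ᵐ w ∂envLaw ν, Survives w → ∃ D ⊆ limitSet Φ w, D.Nonempty ∧ HyperplaneDiffuse D ∧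
      (Φ.OpenSetCondition → AhlforsRegular D ∧ ENNReal.ofReal t ≤ dimH D ∧
        dimH D ≤ ENNReal.ofReal t') := by
  obtain ⟨B, n, ρ, ε, hρ0, hρ1, hε, hBne, hB, hspread, hBp⟩ :=
    exists_homogeneous_spread_finset Φ ν hd hp hplanar
  obtain ⟨k, R, V, M, hk, hR0, hR1, hM, hV, hN, hN', hpos⟩ :=
    exists_core ν Φ.ratio_pos Φ.ratio_lt_one hp hδ0 hδ hBne (fun b hb => (hB b hb).1) hρ0 hρ1 hBp
      ht htt' ht'
  have hmeas : MeasurableSet (⋂ m, coreSet V B M m) :=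
    MeasurableSet.iInter fun m => measurableSet_coreSet m
  filter_upwards [ae_survives_imp_exists_shift_mem ν hsuper hmeas hpos fun w hw =>
    survives_of_mem_iInter_coreSet (fun v hv => (hV v hv).1) hk (by omega) hBne hw] with w hw hs
  obtain ⟨v, hv, hvH⟩ := hw hs
  obtain ⟨H, hH⟩ :=
    exists_homogeneousTree hV hB hspread hBne hM hk hR0 hR1 hρ0 hρ1 hε hv hvH
  exact ⟨H.carrier, H.carrier_subset_limitSet hH, H.carrier_nonempty, H.hyperplaneDiffuse_carrier,
    fun hosc => H.ahlforsRegular_and_le_dimH hosc ht hN hN'⟩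

end Dimension

/-! ### From the canonical space to an arbitrary Galton–Watson family -/

theorem IsGaltonWatsonFamily.map_eq_envLaw {Λ Ω : Type*} [MeasurableSpace Ω]
    {W : List Λ → Ω → Set Λ} {ν : Measure (Set Λ)} {P : Measure Ω}
    (hW : IsGaltonWatsonFamily W ν P) : P.map (fun ω a => W a ω) = envLaw ν := by
  rw [hW.iIndepFun.map_fun_eq_infinitePi_map hW.measurable, envLaw]
  simp_rw [hW.map_eq]

/-- This direction needs no measurability of `p`. Non-planarity is carried the other way by
contraposition, so planarity need not be shown measurable. -/
theorem IsGaltonWatsonFamily.ae_of_ae_envLaw {Λ Ω : Type*} [MeasurableSpace Ω]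
    {W : List Λ → Ω → Set Λ} {ν : Measure (Set Λ)} {P : Measure Ω}
    (hW : IsGaltonWatsonFamily W ν P) {p : (List Λ → Set Λ) → Prop}
    (h : ∀ᵐ w ∂envLaw ν, p w) : ∀ᵐ ω ∂P, p fun a => W a ω := by
  rw [← hW.map_eq_envLaw] at h
  exact ae_of_ae_map (measurable_pi_iff.2 hW.measurable).aemeasurable h

end GWFractal

open GWFractal in
theorem mainTheorem2 {d : ℕ} (hd : 0 < d) {Λ : Type*} [Finite Λ] [Nonempty Λ]
    (Φ : GWFractal.SimilarityIFS d Λ)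
    (ν : Measure (Set Λ)) [IsProbabilityMeasure ν]
    (hpos : ∀ i : Λ, 0 < ν {s | i ∈ s})
    (hsuper : 1 < ∫ s : Set Λ, (s.ncard : ℝ) ∂ν)
    {Ω : Type*} [MeasurableSpace Ω] (P : Measure Ω) [IsProbabilityMeasure P]
    (W : List Λ → Ω → Set Λ) (hW : GWFractal.IsGaltonWatsonFamily W ν P)
    (hplanar : GWFractal.NonPlanar Φ W P) :
    (∀ᵐ ω ∂P, GWFractal.Survives (fun a => W a ω) →
      ∃ D : Set (GWFractal.Euc d), D ⊆ GWFractal.limitSet Φ (fun a => W a ω) ∧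
        D.Nonempty ∧ GWFractal.HyperplaneDiffuse D) ∧
    (Φ.OpenSetCondition →
      ∀ᵐ ω ∂P, GWFractal.Survives (fun a => W a ω) →
        ∃ D : ℕ → Set (GWFractal.Euc d),
          (∀ n, D n ⊆ GWFractal.limitSet Φ (fun a => W a ω) ∧ (D n).Nonempty ∧
            GWFractal.HyperplaneDiffuse (D n) ∧ GWFractal.AhlforsRegular (D n)) ∧
          StrictMono (fun n => dimH (D n)) ∧
          Tendsto (fun n => dimH (D n)) atTop
            (𝓝 (dimH (GWFractal.limitSet Φ (fun a => W a ω))))) := by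
  classical
  cases nonempty_fintype Λ
  have hp : ∀ i, 0 < letterProb ν i := fun i =>
    ENNReal.toReal_pos (hpos i).ne' (measure_ne_top _ _)
  obtain ⟨δ, hδ0, hδ⟩ := exists_dimension ν Φ.ratio_pos Φ.ratio_lt_one
    (integral_ncard_eq ν ▸ hsuper)
  have hplanar' : ¬ ∀ᵐ w ∂envLaw ν, ∃ L : AffineSubspace ℝ (Euc d), IsHyperplane L ∧
      limitSet Φ w ⊆ (L : Set (Euc d)) := fun h => hplanar (hW.ae_of_ae_envLaw h)
  have hmain : ∀ {t t' : ℝ}, 0 < t → t < t' → t' < δ → _ := fun {t t'} ht htt' ht' =>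
    ae_exists_diffuse_subset Φ ν hd hp hsuper hδ0 hδ hplanar' ht htt' ht'
  refine ⟨?_, fun hosc => ?_⟩
  · refine hW.ae_of_ae_envLaw (p := fun w => Survives w → ∃ D : Set (Euc d),
      D ⊆ limitSet Φ w ∧ D.Nonempty ∧ HyperplaneDiffuse D) ?_
    -- Any interval below `δ` would do; the open set condition is not invoked.
    filter_upwards [hmain (t := δ / 3) (t' := δ / 2) (by linarith) (by linarith) (by linarith)]
      with w hw hs
    obtain ⟨D, hD, hne, hdiff, -⟩ := hw hs
    exact ⟨D, hD, hne, hdiff⟩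
  · refine hW.ae_of_ae_envLaw (p := fun w => Survives w → ∃ D : ℕ → Set (Euc d),
      (∀ n, D n ⊆ limitSet Φ w ∧ (D n).Nonempty ∧ HyperplaneDiffuse (D n) ∧
        AhlforsRegular (D n)) ∧ StrictMono (fun n => dimH (D n)) ∧
        Tendsto (fun n => dimH (D n)) atTop (𝓝 (dimH (limitSet Φ w)))) ?_
    set τ : ℕ → ℝ := fun n => δ * (1 - 1 / ((n : ℝ) + 2)) with hτ
    have hτ0 : ∀ n, 0 < τ n := fun n => by
      have h1 : 1 / ((n : ℝ) + 2) < 1 := by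
        rw [div_lt_one (by positivity)]
        linarith [Nat.cast_nonneg (α := ℝ) n]
      exact mul_pos hδ0 (by linarith)
    have hτδ : ∀ n, τ n < δ := fun n => by
      have h1 : 0 < 1 / ((n : ℝ) + 2) := by positivity
      have := mul_pos hδ0 h1
      simp only [hτ]
      linarith
    have hτmono : StrictMono τ := strictMono_nat_of_lt_succ fun n => by
      have h1 : 1 / (((n + 1 : ℕ) : ℝ) + 2) < 1 / ((n : ℝ) + 2) :=
        one_div_lt_one_div_of_lt (by positivity) (by push_cast; linarith)
      exact mul_lt_mul_of_pos_left (by linarith) hδ0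
    have hτlim : Tendsto τ atTop (𝓝 δ) := by
      have h1 := (tendsto_one_div_add_atTop_nhds_zero_nat (𝕜 := ℝ)).comp (tendsto_add_atTop_nat 1)
      have h2 := (h1.const_sub 1).const_mul δ
      rw [sub_zero, mul_one] at h2
      refine h2.congr fun n => ?_
      simp only [hτ, Function.comp_apply, Nat.cast_add, Nat.cast_one]
      rw [add_assoc, one_add_one_eq_two]
    -- The dimension of `D n` will lie between `τ n` and this midpoint. These intervals are
    -- disjoint, which makes the dimensions strictly increasing.
    have hmid : ∀ n, τ n < (τ n + τ (n + 1)) / 2 ∧ (τ n + τ (n + 1)) / 2 < τ (n + 1) := fun n => by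
      have := hτmono (Nat.lt_succ_self n)
      constructor <;> linarith
    have hall := ae_all_iff.2 fun n =>
      hmain (hτ0 n) (hmid n).1 ((hmid n).2.trans (hτδ (n + 1)))
    filter_upwards [hall, ae_dimH_limitSet_le Φ ν hp hδ0 hδ] with w hw hdim hs
    choose D hD hne hdiff hreg using fun n => hw n hs
    refine ⟨D, fun n => ⟨hD n, hne n, hdiff n, (hreg n hosc).1⟩,
      strictMono_nat_of_lt_succ fun n => ?_, ?_⟩
    · refine ((hreg n hosc).2.2).trans_lt (lt_of_lt_of_le ?_ (hreg (n + 1) hosc).2.1)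
      exact (ENNReal.ofReal_lt_ofReal_iff (hτ0 (n + 1))).2 (hmid n).2
    · have hlow : Tendsto (fun n => ENNReal.ofReal (τ n)) atTop (𝓝 (ENNReal.ofReal δ)) :=
        (ENNReal.continuous_ofReal.tendsto _).comp hτlim
      -- The lower bound for the dimension of the limit set comes from the subsets `D n` themselves.
      have hδle : ENNReal.ofReal δ ≤ dimH (limitSet Φ w) :=
        le_of_tendsto' hlow fun n => ((hreg n hosc).2.1).trans (dimH_mono (hD n))
      have heq : dimH (limitSet Φ w) = ENNReal.ofReal δ := le_antisymm hdim hδle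
      rw [heq]
      refine tendsto_of_tendsto_of_tendsto_of_le_of_le hlow tendsto_const_nhds
        (fun n => (hreg n hosc).2.1) fun n => ?_
      rw [← heq]
      exact dimH_mono (hD n)
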